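/- Setting. Let $\mathbf H_k\in\mathbb C^{n_k\times N}$ ($k=1,\dots,K$) and $\mathbf G_m\in\mathbb C^{\tilde n_m\times N}$ ($m=1,\dots,M$), let $P_1,\dots,P_N>0$, $I_1,\dots,I_M>0$ and $P>0$. For each $k$ let the columns of $\bar{\mathbf V}_k\in\mathbb C^{N\times\bar n_k}$ be a basis of the null space of the matrix obtained by stacking the $\mathbf H_j$, $j\ne k$. Put $\tilde{\mathbf H}_k=\mathbf H_k\bar{\mathbf V}_k$ and $\tilde{\mathbf G}_{mk}=\mathbf G_m\bar{\mathbf V}_k$. The relaxed problem is $$\max_{\mathbf S_1,\dots,\mathbf S_K\succeq 0}\ \sum_k\log|\mathbf I+\tilde{\mathbf H}_k\mathbf S_k\tilde{\mathbf H}_k^H|\quad\text{s.t.}\quad \sum_k[\bar{\mathbf V}_k\mathbf S_k\bar{\mathbf V}_k^H]_{i,i}\le P_i\ \ \forall i,\qquad \sum_k\operatorname{tr}(\tilde{\mathbf G}_{mk}\mathbf S_k\tilde{\mathbf G}_{mk}^H)\le I_m\ \ \forall m ,$$ and the rank-constrained problem has in addition $\operatorname{rank}\mathbf S_k\le n_k$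 for all $k$. For $\psi=(\eta,\lambda)\in\mathbb R^{N}\times\mathbb R^M$ let $\Lambda=\operatorname{diag}(\eta)+\sum_m\lambda_m\mathbf G_m^H\mathbf G_m$, $\Omega_k=\bar{\mathbf V}_k^H\Lambda\bar{\mathbf V}_k$, $p=(P_1,\dots,P_N,I_1,\dots,I_M)$. Let $\mathcal D$ be the set of $\psi\ge0$ for which every $\Omega_k$ is positive definite, and for $\psi\in\mathcal D$ and $\mathbf Q=(\mathbf Q_k)$ with $\mathbf Q_k\in\mathbb C^{n_k\times n_k}$, $\mathbf Q_k\succeq0$, let $$f(\psi,\mathbf Q)=\sum_k\log\frac{|\Omega_k+\tilde{\mathbf H}_k^H\mathbf Q_k\tilde{\mathbf H}_k|}{|\Omega_k|}.$$ The dual MAC program is to minimize over $\psi\in\mathcal D$ with $p^T\psi\le P$ the maximum of $f(\psi,\mathbf Q)$ over all $\mathbf Q_k\succeq0$ with $\sum_k\operatorname{tr}\mathbf Q_k\le P$. A solution of it is an admissible pair $(\psi,\mathbf Q)$ such that $\mathbf Q$ attains the inner maximum at $\psi$ and $\psi$ minimizes the inner maximum; in particular, every saddle point of $f$ is a solution.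 Theorem. (a) $f$ is convex in $\psi\in\mathcal D$ for fixed $\mathbf Q$ and concave in $\mathbf Q\succeq 0$ for fixed $\psi\in\mathcal D$. (b) The relaxed problem attains its maximum $v$. The rank-constrained problem attains the same maximum $v$ (the rank relaxation is tight). For every admissible $\psi$ the inner maximum of the dual MAC program is attained, and the infimum over $\psi$ of these maxima is $v$. (c) Suppose that for every $\psi\ge0$ with $\ker\Omega_k\subseteq\ker\tilde{\mathbf H}_k$ for all $k$, all $\Omega_k$ are positive definite (this holds for generic channels). Then the dual MAC program has a saddle point. Suppose from now on that $\tilde{\mathbf H}_k\ne0$ for at least one $k$. (d) The constraints $\sum_k\operatorname{tr}\mathbf Q_k\le P$ and $p^T\psi\le P$ may be replaced by equalities: the program with equalities has the same value $v$ and exactly the same solutions. (e) Let $(\psi,\mathbf Q)$ be a solution of the dual MAC program. Then each $\tilde{\mathbf H}_k\Omega_k^{-1/2}$ has a singular value decomposition $\mathbf U_k\mathbf D_k\mathbf V_k^H$ with $\mathbf D_k$ square, diagonal and nonnegative and with $\mathbf U_k,\mathbf V_k$ having orthonormal columns, and for every such choice of decompositions $$\mathbf S_k=\Omega_k^{-1/2}\mathbf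 V_k\mathbf U_k^H\mathbf Q_k\mathbf U_k\mathbf V_k^H\Omega_k^{-1/2}\qquad(k=1,\dots,K)$$ is the optimal solution of the relaxed problem, that is, it is optimal and no other solution is. In particular every optimal solution of the relaxed problem satisfies $\operatorname{rank}\mathbf S_k\le n_k$ for all $k$. -/

import Mathlib

open scoped Matrix ComplexOrder

noncomputable section

/-- Data of an underlay cognitive MIMO downlink: an `N`-antenna secondary base station, `K`
secondary users (user `k` has `n k` receive antennas and channel `H k`), `M` primary users
(user `m` has `nt m` receive antennas and channel `G m`), the per-antenna power limits, the
interference thresholds, and matrices `V k` with `nb k` columns used for zero forcing. -/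
structure CRNetwork (K M N : ℕ) (n nb : Fin K → ℕ) (nt : Fin M → ℕ) where
  /-- channels to the secondary users -/
  H : (k : Fin K) → Matrix (Fin (n k)) (Fin N) ℂ
  /-- channels to the primary users -/
  G : (m : Fin M) → Matrix (Fin (nt m)) (Fin N) ℂ
  /-- zero-forcing matrices -/
  V : (k : Fin K) → Matrix (Fin N) (Fin (nb k)) ℂ
  /-- power limit of each transmit antenna -/
  power : Fin N → ℝ
  /-- interference threshold at each primary user -/
  interf : Fin M → ℝ

/-- The inverse square root of a positive definite Hermitian matrix. -/
def invSqrt {d : ℕ} (A : Matrix (Fin d) (Fin d) ℂ) : Matrix (Fin d) (Fin d) ℂ :=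
  cfc (fun x : ℝ => (Real.sqrt x)⁻¹) A

/-- `A = U diag(D) Vᴴ` is a singular value decomposition with a square diagonal `D`: the columns
of `U` and those of `V` are orthonormal and the entries of `D` are nonnegative reals. -/
def IsThinSVD {a b r : ℕ} (A : Matrix (Fin a) (Fin b) ℂ) (U : Matrix (Fin a) (Fin r) ℂ)
    (D : Fin r → ℝ) (V : Matrix (Fin b) (Fin r) ℂ) : Prop :=
  Uᴴ * U = 1 ∧ Vᴴ * V = 1 ∧ (∀ i, 0 ≤ D i) ∧
    A = U * Matrix.diagonal (fun i => (D i : ℂ)) * Vᴴ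

/-- `(x, y)` solves `min_{x ∈ A} max_{y ∈ B} f x y`: `y` attains the inner maximum at `x`, and
the inner maximum at any other admissible `x'` is not smaller. -/
def IsMinimaxSolution {X Y : Type*} (f : X → Y → ℝ) (A : Set X) (B : Set Y) (x : X) (y : Y) :
    Prop :=
  x ∈ A ∧ y ∈ B ∧ (∀ y' ∈ B, f x y' ≤ f x y) ∧ ∀ x' ∈ A, ∃ y' ∈ B, f x y ≤ f x' y'

/-- `(x, y)` is a saddle point of `f` on `A × B` (minimizing in `x`, maximizing in `y`). -/
def IsMinimaxSaddle {X Y : Type*} (f : X → Y → ℝ) (A : Set X) (B : Set Y) (x : X) (y : Y) :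
    Prop :=
  x ∈ A ∧ y ∈ B ∧ (∀ y' ∈ B, f x y' ≤ f x y) ∧ ∀ x' ∈ A, f x y ≤ f x' y

/-- The set of the (attained) inner maxima `max_{y ∈ B} f x y`, for `x ∈ A`. -/
def innerMaxima {X Y : Type*} (f : X → Y → ℝ) (A : Set X) (B : Set Y) : Set ℝ :=
  {w | ∃ x ∈ A, IsGreatest (f x '' B) w}

namespace CRNetwork

variable {K M N : ℕ} {n nb : Fin K → ℕ} {nt : Fin M → ℕ}

/-- The channels of all secondary users but the `k`-th, stacked. -/
def Hbar (c : CRNetwork K M N n nb nt) (k : Fin K) :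
    Matrix (Σ j : {j : Fin K // j ≠ k}, Fin (n j)) (Fin N) ℂ :=
  Matrix.of fun p i => c.H p.1 p.2 i

/-- For each `k` the columns of `V k` are a basis of the null space of `Hbar k`. -/
def IsZeroForcing (c : CRNetwork K M N n nb nt) : Prop :=
  ∀ k, LinearIndependent ℂ (c.V k).col ∧
    Submodule.span ℂ (Set.range (c.V k).col) = LinearMap.ker (c.Hbar k).mulVecLin

/-- The effective channel `H_k V_k`. -/
def Htilde (c : CRNetwork K M N n nb nt) (k : Fin K) : Matrix (Fin (n k)) (Fin (nb k)) ℂ :=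
  c.H k * c.V k

/-- The effective interference channel `G_m V_k`. -/
def Gtilde (c : CRNetwork K M N n nb nt) (m : Fin M) (k : Fin K) :
    Matrix (Fin (nt m)) (Fin (nb k)) ℂ :=
  c.G m * c.V k

/-- The sum rate. -/
def sumRate (c : CRNetwork K M N n nb nt)
    (S : (k : Fin K) → Matrix (Fin (nb k)) (Fin (nb k)) ℂ) : ℝ :=
  ∑ k, Real.log (1 + c.Htilde k * S k * (c.Htilde k)ᴴ).det.re

/-- The feasible set of the rank-relaxed problem. -/
def relaxedFeasible (c : CRNetwork K M N n nb nt) :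
    Set ((k : Fin K) → Matrix (Fin (nb k)) (Fin (nb k)) ℂ) :=
  {S | (∀ k, (S k).PosSemidef) ∧
    (∀ i, ∑ k, ((c.V k * S k * (c.V k)ᴴ) i i).re ≤ c.power i) ∧
    (∀ m, ∑ k, (c.Gtilde m k * S k * (c.Gtilde m k)ᴴ).trace.re ≤ c.interf m)}

/-- The feasible set of the problem with the rank constraints. -/
def rankFeasible (c : CRNetwork K M N n nb nt) :
    Set ((k : Fin K) → Matrix (Fin (nb k)) (Fin (nb k)) ℂ) :=
  {S | S ∈ c.relaxedFeasible ∧ ∀ k, (S k).rank ≤ n k}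

/-- `S` is an optimal solution of the rank-relaxed problem. -/
def IsRelaxedOptimal (c : CRNetwork K M N n nb nt)
    (S : (k : Fin K) → Matrix (Fin (nb k)) (Fin (nb k)) ℂ) : Prop :=
  S ∈ c.relaxedFeasible ∧ ∀ S' ∈ c.relaxedFeasible, c.sumRate S' ≤ c.sumRate S

/-- The matrix `Λ = diag(η) + ∑ₘ λₘ Gₘᴴ Gₘ`, where `ψ = (η, λ)`. -/
def Lam (c : CRNetwork K M N n nb nt) (ψ : Fin N ⊕ Fin M → ℝ) : Matrix (Fin N) (Fin N) ℂ :=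
  Matrix.diagonal (fun i => (ψ (Sum.inl i) : ℂ)) +
    ∑ m, (ψ (Sum.inr m) : ℂ) • ((c.G m)ᴴ * c.G m)

/-- The matrix `Ω_k = V_kᴴ Λ V_k`. -/
def Omega (c : CRNetwork K M N n nb nt) (ψ : Fin N ⊕ Fin M → ℝ) (k : Fin K) :
    Matrix (Fin (nb k)) (Fin (nb k)) ℂ :=
  (c.V k)ᴴ * c.Lam ψ * c.V k

/-- The vector `p` of all power limits and interference thresholds. -/
def limits (c : CRNetwork K M N n nb nt) : Fin N ⊕ Fin M → ℝ :=
  Sum.elim c.power c.interf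

/-- The objective of the dual multiple-access problem. -/
def dualObjective (c : CRNetwork K M N n nb nt) (ψ : Fin N ⊕ Fin M → ℝ)
    (Q : (k : Fin K) → Matrix (Fin (n k)) (Fin (n k)) ℂ) : ℝ :=
  ∑ k, Real.log ((c.Omega ψ k + (c.Htilde k)ᴴ * Q k * c.Htilde k).det.re /
    (c.Omega ψ k).det.re)

/-- The multipliers `ψ ≥ 0` at which the dual objective is defined: every `Ω_k`, which is
positive semidefinite, has to be invertible. -/
def dualDomain (c : CRNetwork K M N n nb nt) : Set (Fin N ⊕ Fin M → ℝ) :=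
  {ψ | (∀ i, 0 ≤ ψ i) ∧ ∀ k, (c.Omega ψ k).PosDef}

/-- The multipliers admitted by the dual problem: `ψ ≥ 0` and `pᵀ ψ ≤ P`. -/
def dualMultipliers (c : CRNetwork K M N n nb nt) (P : ℝ) : Set (Fin N ⊕ Fin M → ℝ) :=
  {ψ | ψ ∈ c.dualDomain ∧ c.limits ⬝ᵥ ψ ≤ P}

/-- The multipliers with the power constraint as an equality, `pᵀ ψ = P`. -/
def dualMultipliersEq (c : CRNetwork K M N n nb nt) (P : ℝ) : Set (Fin N ⊕ Fin M → ℝ) :=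
  {ψ | ψ ∈ c.dualDomain ∧ c.limits ⬝ᵥ ψ = P}

/-- The recovered covariances `S_k = Ω_k^{-1/2} V_k U_kᴴ Q_k U_k V_kᴴ Ω_k^{-1/2}`, where `U_k`
and `V_k` (here `W k`) are the singular vectors. -/
def recovered (c : CRNetwork K M N n nb nt) (ψ : Fin N ⊕ Fin M → ℝ)
    (Q : (k : Fin K) → Matrix (Fin (n k)) (Fin (n k)) ℂ) {r : Fin K → ℕ}
    (U : (k : Fin K) → Matrix (Fin (n k)) (Fin (r k)) ℂ)
    (W : (k : Fin K) → Matrix (Fin (nb k)) (Fin (r k)) ℂ) (k : Fin K) :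
    Matrix (Fin (nb k)) (Fin (nb k)) ℂ :=
  invSqrt (c.Omega ψ k) * W k * (U k)ᴴ * Q k * U k * (W k)ᴴ * invSqrt (c.Omega ψ k)

end CRNetwork

/-- The positive semidefinite tuples `Q`. -/
def psdTuples {K : ℕ} (n : Fin K → ℕ) : Set ((k : Fin K) → Matrix (Fin (n k)) (Fin (n k)) ℂ) :=
  {Q | ∀ k, (Q k).PosSemidef}

/-- The positive semidefinite tuples `Q` with `∑ₖ tr Q_k ≤ P`. -/
def dualCovariances {K : ℕ} (n : Fin K → ℕ) (P : ℝ) :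
    Set ((k : Fin K) → Matrix (Fin (n k)) (Fin (n k)) ℂ) :=
  {Q | Q ∈ psdTuples n ∧ ∑ k, (Q k).trace.re ≤ P}

/-- The positive semidefinite tuples `Q` with `∑ₖ tr Q_k = P`. -/
def dualCovariancesEq {K : ℕ} (n : Fin K → ℕ) (P : ℝ) :
    Set ((k : Fin K) → Matrix (Fin (n k)) (Fin (n k)) ℂ) :=
  {Q | Q ∈ psdTuples n ∧ ∑ k, (Q k).trace.re = P}

end

/-!
For `ψ` in the dual domain put `A_k = H_k V_k Ω_k^{-1/2}`. Substituting
`S_k = Ω_k^{-1/2} T_k Ω_k^{-1/2}` turns the downlink rate under the single priced constraint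
`∑ₖ tr (Ω_k S_k) ≤ P` into `∑ₖ log det (1 + A_k T_k A_kᴴ)` under `∑ₖ tr T_k ≤ P`, and the dual
objective is `∑ₖ log det (1 + A_kᴴ Q_k A_k)` under `∑ₖ tr Q_k ≤ P`. The map `Q ↦ W Uᴴ Q U Wᴴ` given
by a singular value decomposition `A = U D Wᴴ` preserves the rate and does not increase the trace
(`dual_covariance`), so that the inner maximum of the dual program at `ψ` is the maximal downlink
rate under the priced constraint. As `∑ₖ tr (Ω_k S_k)` is the scalar product of `ψ` with the vector
of used resources (`CRNetwork.sum_trace_Omega_mul`), the priced constraint relaxes the constraints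
of the primal problem, which is weak duality. Lagrange multipliers of the primal problem
(`exists_lagrange_multipliers`), moved slightly into the interior and rescaled, give multipliers
whose inner maximum is arbitrarily close to the primal value (`CRNetwork.exists_dual_le`).

Uniqueness rests on the tangent inequality for `log det` with its case of equality
(`Matrix.PosDef.log_det_le`): two maximizers agree at the receivers, and since a maximizer spends
all the power and wastes none of it outside the row spaces of the channels, it is determined by
what the receivers see (`max_unique`). At a solution `(ψ, Q)` every primal optimum also maximizes
the rate under the priced constraint, as does the covariance obtained from `Q` by the duality map;
hence they coincide (`CRNetwork.eq_recovered`). Uniqueness of the inner maximizer and convexity in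
`ψ` also show that a solution is a saddle point (`CRNetwork.le_dualObjective_of_minimax`); the
regularity assumption on the channels puts the Lagrange multipliers themselves into the dual
domain, which provides a solution.

The tightness of the rank relaxation needs no dual solution: any `S` can be replaced by a smaller
covariance of rank at most `n_k` that is received identically (`Matrix.PosSemidef.exists_rank_le`).
-/

noncomputable section

open Matrix

/-! ### The concave function `log det` -/

namespace Matrix

section Elementary

variable {n : Type*}

theorem PosSemidef.smul_real {A : Matrix n n ℂ} (hA : A.PosSemidef) {t : ℝ} (ht : 0 ≤ t) :
    (t • A).PosSemidef := hA.smul ht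

theorem PosDef.smul_real {A : Matrix n n ℂ} (hA : A.PosDef) {t : ℝ} (ht : 0 < t) :
    (t • A).PosDef := hA.smul ht

theorem PosSemidef.trace_re_nonneg [Fintype n] {A : Matrix n n ℂ} (hA : A.PosSemidef) :
    0 ≤ A.trace.re :=
  (Complex.nonneg_iff.mp hA.trace_nonneg).1

theorem PosSemidef.eq_zero_of_trace_re [Fintype n] {A : Matrix n n ℂ} (hA : A.PosSemidef)
    (h : A.trace.re = 0) : A = 0 :=
  hA.trace_eq_zero_iff.mp (Complex.ext h (Complex.nonneg_iff.mp hA.trace_nonneg).2.symm)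

end Elementary

variable {n : Type*} [Fintype n] [DecidableEq n]

open scoped MatrixOrder in
theorem PosSemidef.exists_eq_conjTranspose_mul_self {A : Matrix n n ℂ} (hA : A.PosSemidef) :
    ∃ B : Matrix n n ℂ, A = Bᴴ * B :=
  CStarAlgebra.nonneg_iff_eq_star_mul_self.mp hA.nonneg

open scoped MatrixOrder in
theorem PosSemidef.posDef_of_det_ne_zero {A : Matrix n n ℂ} (hA : A.PosSemidef)
    (h : A.det ≠ 0) : A.PosDef :=
  hA.posDef_iff_det_ne_zero.mpr h

theorem PosDef.det_re_pos {A : Matrix n n ℂ} (hA : A.PosDef) : 0 < A.det.re :=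
  (Complex.pos_iff.mp hA.det_pos).1

theorem PosDef.ofReal_det_re {A : Matrix n n ℂ} (hA : A.PosDef) : (A.det.re : ℂ) = A.det :=
  Complex.ext rfl (Complex.pos_iff.mp hA.det_pos).2

theorem PosDef.isUnit_det {A : Matrix n n ℂ} (hA : A.PosDef) : IsUnit A.det :=
  (Matrix.isUnit_iff_isUnit_det A).mp hA.isUnit

theorem PosSemidef.trace_mul_re_nonneg {A B : Matrix n n ℂ} (hA : A.PosSemidef)
    (hB : B.PosSemidef) : 0 ≤ (A * B).trace.re := by
  obtain ⟨C, rfl⟩ := hA.exists_eq_conjTranspose_mul_self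
  rw [Matrix.mul_assoc, Matrix.trace_mul_comm]
  exact (hB.mul_mul_conjTranspose_same C).trace_re_nonneg

/-- The tangent inequality for the concave function `log det`, in the form normalised at the
identity: it is `log x ≤ x - 1` summed over the eigenvalues. -/
theorem PosDef.log_det_le_trace {Z : Matrix n n ℂ} (hZ : Z.PosDef) :
    Real.log Z.det.re ≤ Z.trace.re - Fintype.card n ∧
      (Real.log Z.det.re = Z.trace.re - Fintype.card n → Z = 1) := by
  have hpos := hZ.eigenvalues_pos
  have hdet : Z.det.re = ∏ i, hZ.1.eigenvalues i := by
    rw [hZ.1.det_eq_prod_eigenvalues]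
    norm_cast
  have htr : Z.trace.re - Fintype.card n = ∑ i, (hZ.1.eigenvalues i - 1) := by
    rw [hZ.1.trace_eq_sum_eigenvalues]
    simp
  rw [hdet, htr, Real.log_prod (fun i _ => (hpos i).ne')]
  have hle : ∀ i ∈ Finset.univ, Real.log (hZ.1.eigenvalues i) ≤ hZ.1.eigenvalues i - 1 :=
    fun i _ => Real.log_le_sub_one_of_pos (hpos i)
  refine ⟨Finset.sum_le_sum hle, fun h => ?_⟩
  have h1 := (Finset.sum_eq_sum_iff_of_le hle).mp h
  have h2 : hZ.1.eigenvalues = 1 := by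
    ext i
    by_contra hne
    exact (Real.log_lt_sub_one_of_pos (hpos i) hne).ne (h1 i (Finset.mem_univ i))
  have h3 := hZ.1.spectral_theorem
  rw [h2] at h3
  rw [h3]
  have : (diagonal (RCLike.ofReal ∘ (1 : n → ℝ)) : Matrix n n ℂ) = 1 := by
    ext i j
    simp [Matrix.diagonal_apply, Matrix.one_apply]
  rw [this, map_one]

/-- `log det` lies below its tangents, and meets a tangent only at the point of contact. -/
theorem PosDef.log_det_le {X Y : Matrix n n ℂ} (hX : X.PosDef) (hY : Y.PosDef) :
    Real.log X.det.re ≤ Real.log Y.det.re + ((Y⁻¹ * X).trace.re - Fintype.card n) ∧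
      (Real.log X.det.re = Real.log Y.det.re + ((Y⁻¹ * X).trace.re - Fintype.card n) →
        X = Y) := by
  obtain ⟨B, hB⟩ := hY.inv.posSemidef.exists_eq_conjTranspose_mul_self
  have hBu : IsUnit B.det := by
    have h : IsUnit (Bᴴ * B).det := hB ▸ hY.inv.isUnit_det
    rw [Matrix.det_mul] at h
    exact isUnit_of_mul_isUnit_right h
  have hBHu : IsUnit Bᴴ.det := by
    rw [Matrix.det_conjTranspose]
    exact hBu.star
  have hinj : Function.Injective Bᴴ.mulVec :=
    Matrix.mulVec_injective_iff_isUnit.mpr ((Matrix.isUnit_iff_isUnit_det _).mpr hBHu)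
  have hZ : (B * X * Bᴴ).PosDef := by
    have := hX.conjTranspose_mul_mul_same hinj
    rwa [Matrix.conjTranspose_conjTranspose] at this
  have htr : (B * X * Bᴴ).trace = (Y⁻¹ * X).trace := by
    rw [Matrix.trace_mul_cycle, ← hB]
  have hdet : Real.log (B * X * Bᴴ).det.re = Real.log X.det.re - Real.log Y.det.re := by
    have h1 : (B * X * Bᴴ).det = X.det / Y.det := by
      have : (B * X * Bᴴ).det = X.det * (Bᴴ * B).det := by
        simp only [Matrix.det_mul]; ring
      rw [this, ← hB, Matrix.det_nonsing_inv, Ring.inverse_eq_inv', div_eq_mul_inv]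
    rw [h1, ← hX.ofReal_det_re, ← hY.ofReal_det_re, ← Complex.ofReal_div, Complex.ofReal_re,
      Real.log_div hX.det_re_pos.ne' hY.det_re_pos.ne', Complex.ofReal_re, Complex.ofReal_re]
  obtain ⟨h1, h2⟩ := hZ.log_det_le_trace
  rw [hdet, htr] at h1 h2
  refine ⟨by linarith, fun h => ?_⟩
  have h3 := h2 (by linarith)
  have h4 : Y⁻¹ * X = 1 := by
    have : B * (X * Bᴴ) = 1 := by rw [← Matrix.mul_assoc, h3]
    have h5 : X * Bᴴ * B = 1 := by rw [mul_eq_one_comm, this]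
    rw [hB, mul_eq_one_comm, ← Matrix.mul_assoc, h5]
  calc X = Y * (Y⁻¹ * X) := by
        rw [← Matrix.mul_assoc, Matrix.mul_nonsing_inv _ hY.isUnit_det, Matrix.one_mul]
    _ = Y := by rw [h4, Matrix.mul_one]

/-- Strict monotonicity of `log det` for the Loewner order. -/
theorem PosDef.log_det_mono {X Y : Matrix n n ℂ} (hX : X.PosDef) (hYX : (Y - X).PosSemidef) :
    Real.log X.det.re ≤ Real.log Y.det.re ∧
      (Real.log X.det.re = Real.log Y.det.re → X = Y) := by
  have hY : Y.PosDef := by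
    have := hX.add_posSemidef hYX
    rwa [add_sub_cancel] at this
  obtain ⟨h1, h2⟩ := hX.log_det_le hY
  have h3 := hY.inv.posSemidef.trace_mul_re_nonneg hYX
  rw [Matrix.mul_sub, Matrix.nonsing_inv_mul _ hY.isUnit_det, Matrix.trace_sub,
    Matrix.trace_one, Complex.sub_re, Complex.natCast_re] at h3
  exact ⟨by linarith, fun h => h2 (by linarith)⟩

/-- Strict concavity of `log det`. -/
theorem PosDef.log_det_concave {X Y : Matrix n n ℂ} (hX : X.PosDef) (hY : Y.PosDef) {a b : ℝ}
    (ha : 0 ≤ a) (hb : 0 ≤ b) (hab : a + b = 1) :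
    a * Real.log X.det.re + b * Real.log Y.det.re ≤ Real.log (a • X + b • Y).det.re ∧
      (0 < a → 0 < b →
        a * Real.log X.det.re + b * Real.log Y.det.re = Real.log (a • X + b • Y).det.re →
        X = Y) := by
  have hZ : (a • X + b • Y).PosDef := by
    rcases ha.eq_or_lt with rfl | ha
    · have : b = 1 := by linarith
      simpa [this] using hY
    · exact (hX.smul_real ha).add_posSemidef (hY.posSemidef.smul_real hb)
  obtain ⟨h1, h1'⟩ := hX.log_det_le hZ
  obtain ⟨h2, h2'⟩ := hY.log_det_le hZ
  set Z := a • X + b • Y with hZdef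
  have h3 : a * (Z⁻¹ * X).trace.re + b * (Z⁻¹ * Y).trace.re = Fintype.card n := by
    have : (Z⁻¹ * Z).trace = Fintype.card n := by
      rw [Matrix.nonsing_inv_mul _ hZ.isUnit_det, Matrix.trace_one]
    have := congrArg Complex.re this
    rw [Complex.natCast_re] at this
    rw [← this]
    conv_rhs => rw [show Z⁻¹ * Z = Z⁻¹ * (a • X + b • Y) from rfl, Matrix.mul_add,
      Matrix.mul_smul, Matrix.mul_smul]
    simp
  have hx : a * Real.log X.det.re ≤
      a * (Real.log Z.det.re + ((Z⁻¹ * X).trace.re - Fintype.card n)) :=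
    mul_le_mul_of_nonneg_left h1 ha
  have hy : b * Real.log Y.det.re ≤
      b * (Real.log Z.det.re + ((Z⁻¹ * Y).trace.re - Fintype.card n)) :=
    mul_le_mul_of_nonneg_left h2 hb
  have hb' : b = 1 - a := by linarith
  have hsum : a * (Real.log Z.det.re + ((Z⁻¹ * X).trace.re - Fintype.card n)) +
      b * (Real.log Z.det.re + ((Z⁻¹ * Y).trace.re - Fintype.card n)) = Real.log Z.det.re := by
    have : a * (Real.log Z.det.re + ((Z⁻¹ * X).trace.re - Fintype.card n)) +
      b * (Real.log Z.det.re + ((Z⁻¹ * Y).trace.re - Fintype.card n)) =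
      (a + b) * (Real.log Z.det.re - Fintype.card n) +
        (a * (Z⁻¹ * X).trace.re + b * (Z⁻¹ * Y).trace.re) := by ring
    rw [this, h3, hab]; ring
  refine ⟨by linarith, fun ha' hb'' h => ?_⟩
  have ex : a * Real.log X.det.re =
      a * (Real.log Z.det.re + ((Z⁻¹ * X).trace.re - Fintype.card n)) := by linarith
  have ey : b * Real.log Y.det.re =
      b * (Real.log Z.det.re + ((Z⁻¹ * Y).trace.re - Fintype.card n)) := by linarith
  rw [h1' (mul_left_cancel₀ ha'.ne' ex), h2' (mul_left_cancel₀ hb''.ne' ey)]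

/-- A gradient inequality for `Ω ↦ log det (Ω + B) - log det Ω`, which makes this function convex.
With `B = C Cᴴ` it is the mutual information of a Gaussian channel `C` with noise covariance `Ω`,
that is `- log det E` for the error matrix `E = 1 - Cᴴ (Ω + B)⁻¹ C` of the optimal linear
receiver; a suboptimal receiver, kept fixed while `Ω` varies, has an error matrix that is larger
and affine in `Ω`. -/
theorem PosDef.exists_subgradient {Ω : Matrix n n ℂ} (hΩ : Ω.PosDef) {B : Matrix n n ℂ}
    (hB : B.PosSemidef) :
    ∃ M : Matrix n n ℂ, ∀ Ω' : Matrix n n ℂ, Ω'.PosDef →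
      Real.log ((Ω + B).det.re / Ω.det.re) - (M * (Ω' - Ω)).trace.re ≤
        Real.log ((Ω' + B).det.re / Ω'.det.re) := by
  obtain ⟨C, rfl⟩ : ∃ C : Matrix n n ℂ, B = C * Cᴴ := by
    obtain ⟨C, rfl⟩ := hB.exists_eq_conjTranspose_mul_self
    exact ⟨Cᴴ, by simp⟩
  -- the error matrix of the receiver `W` under the noise covariance `T`
  let err : Matrix n n ℂ → Matrix n n ℂ → Matrix n n ℂ := fun T W =>
    (1 - Cᴴ * W)ᴴ * (1 - Cᴴ * W) + Wᴴ * T * W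
  let opt : Matrix n n ℂ → Matrix n n ℂ := fun T => (T + C * Cᴴ)⁻¹ * C
  have hX : ∀ T : Matrix n n ℂ, T.PosDef → (T + C * Cᴴ).PosDef := fun T hT =>
    hT.add_posSemidef hB
  have hsq : ∀ T : Matrix n n ℂ, T.PosDef → ∀ W,
      err T W = (1 - Cᴴ * opt T) + (W - opt T)ᴴ * (T + C * Cᴴ) * (W - opt T) := by
    intro T hT W
    have hXT := hX T hT
    have e1 : (T + C * Cᴴ) * opt T = C := by
      simp only [opt]
      rw [← Matrix.mul_assoc, Matrix.mul_nonsing_inv _ hXT.isUnit_det, Matrix.one_mul]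
    have e2 : (opt T)ᴴ * (T + C * Cᴴ) = Cᴴ := by
      have h := congrArg Matrix.conjTranspose e1
      rwa [Matrix.conjTranspose_mul, hXT.1.eq] at h
    have e3 : (W - opt T)ᴴ * (T + C * Cᴴ) * (W - opt T) =
        Wᴴ * (T + C * Cᴴ) * W - Wᴴ * C - Cᴴ * W + Cᴴ * opt T := by
      rw [Matrix.conjTranspose_sub, Matrix.sub_mul, e2, Matrix.sub_mul, Matrix.mul_sub,
        Matrix.mul_assoc Wᴴ _ (opt T), e1, Matrix.mul_sub]
      abel
    rw [e3]
    simp only [err, Matrix.conjTranspose_sub, Matrix.conjTranspose_one, Matrix.conjTranspose_mul,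
      Matrix.conjTranspose_conjTranspose, Matrix.mul_add, Matrix.add_mul, Matrix.sub_mul,
      Matrix.mul_sub, Matrix.one_mul, Matrix.mul_one, Matrix.mul_assoc]
    abel
  have hdet : ∀ T : Matrix n n ℂ, T.PosDef →
      (1 - Cᴴ * opt T).det = T.det / (T + C * Cᴴ).det := by
    intro T hT
    have hXT := hX T hT
    have : 1 - opt T * Cᴴ = (T + C * Cᴴ)⁻¹ * T := by
      have h := Matrix.nonsing_inv_mul _ hXT.isUnit_det
      simp only [opt]
      rw [← h, Matrix.mul_assoc, ← Matrix.mul_sub, add_sub_cancel_right]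
    rw [Matrix.det_one_sub_mul_comm, this, Matrix.det_mul, Matrix.det_nonsing_inv,
      Ring.inverse_eq_inv', div_eq_mul_inv, mul_comm]
  have herr : ∀ T : Matrix n n ℂ, T.PosDef → ∀ W, (err T W).PosSemidef := fun T hT W =>
    (Matrix.posSemidef_conjTranspose_mul_self _).add (hT.posSemidef.conjTranspose_mul_mul_same W)
  have hE : ∀ T : Matrix n n ℂ, T.PosDef → (1 - Cᴴ * opt T).PosDef := by
    intro T hT
    refine PosSemidef.posDef_of_det_ne_zero ?_ ?_
    · have h := herr T hT (opt T)
      rw [hsq T hT] at h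
      simpa using h
    · rw [hdet T hT]
      exact div_ne_zero hT.isUnit_det.ne_zero (hX T hT).isUnit_det.ne_zero
  have hF : ∀ T : Matrix n n ℂ, T.PosDef →
      Real.log ((T + C * Cᴴ).det.re / T.det.re) = - Real.log (1 - Cᴴ * opt T).det.re := by
    intro T hT
    have h1 : (1 - Cᴴ * opt T).det.re = T.det.re / (T + C * Cᴴ).det.re := by
      rw [hdet T hT, ← hT.ofReal_det_re, ← (hX T hT).ofReal_det_re, ← Complex.ofReal_div,
        Complex.ofReal_re, Complex.ofReal_re, Complex.ofReal_re]
    rw [h1, ← Real.log_inv, inv_div]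
  refine ⟨opt Ω * (1 - Cᴴ * opt Ω)⁻¹ * (opt Ω)ᴴ, fun Ω' hΩ' => ?_⟩
  rw [hF Ω hΩ, hF Ω' hΩ']
  have h1 := ((hE Ω' hΩ').log_det_le (hE Ω hΩ)).1
  have h2 := (hE Ω hΩ).inv.posSemidef.trace_mul_re_nonneg
    ((hX Ω' hΩ').posSemidef.conjTranspose_mul_mul_same (opt Ω - opt Ω'))
  have h3 : (opt Ω - opt Ω')ᴴ * (Ω' + C * Cᴴ) * (opt Ω - opt Ω') =
      (1 - Cᴴ * opt Ω) + (opt Ω)ᴴ * (Ω' - Ω) * opt Ω - (1 - Cᴴ * opt Ω') := by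
    have e1 := hsq Ω' hΩ' (opt Ω)
    have e2 := hsq Ω hΩ (opt Ω)
    have e3 : err Ω' (opt Ω) = err Ω (opt Ω) + (opt Ω)ᴴ * (Ω' - Ω) * opt Ω := by
      simp only [err, Matrix.mul_sub, Matrix.sub_mul]
      abel
    rw [e3, e2] at e1
    rw [eq_sub_iff_add_eq, add_comm, ← e1]
    simp
  have h4 : (opt Ω * (1 - Cᴴ * opt Ω)⁻¹ * (opt Ω)ᴴ * (Ω' - Ω)).trace =
      ((1 - Cᴴ * opt Ω)⁻¹ * ((opt Ω)ᴴ * (Ω' - Ω) * opt Ω)).trace := by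
    rw [Matrix.mul_assoc, Matrix.mul_assoc, Matrix.trace_mul_comm]
    simp only [Matrix.mul_assoc]
  rw [h3, Matrix.mul_sub, Matrix.mul_add, Matrix.nonsing_inv_mul _ (hE Ω hΩ).isUnit_det] at h2
  simp only [Matrix.trace_sub, Matrix.trace_add, Matrix.trace_one, Complex.sub_re,
    Complex.add_re, Complex.natCast_re] at h2
  rw [h4]
  linarith

end Matrix

/-! ### Singular value decompositions and rank reduction -/

/-- Existence of a thin singular value decomposition: the columns of `V` are the eigenvectors of
`Aᴴ A` with nonzero eigenvalue, and `U = A V D⁻¹`. -/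
theorem exists_isThinSVD {a b : ℕ} (A : Matrix (Fin a) (Fin b) ℂ) :
    ∃ (r : ℕ) (U : Matrix (Fin a) (Fin r) ℂ) (D : Fin r → ℝ) (V : Matrix (Fin b) (Fin r) ℂ),
      IsThinSVD A U D V := by
  have hA := Matrix.isHermitian_conjTranspose_mul_self A
  have hpsd := Matrix.posSemidef_conjTranspose_mul_self A
  set ev := hA.eigenvalues with hev
  have hnn : ∀ i, 0 ≤ ev i := hpsd.eigenvalues_nonneg
  let E : Matrix (Fin b) (Fin b) ℂ := hA.eigenvectorUnitary
  have hE1 : Eᴴ * E = 1 := by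
    simpa [E, Matrix.star_eq_conjTranspose] using
      (Unitary.mem_iff.mp hA.eigenvectorUnitary.2).1
  have hE2 : E * Eᴴ = 1 := mul_eq_one_comm.mp hE1
  have hdiag : (A * E)ᴴ * (A * E) = diagonal (fun i => (ev i : ℂ)) := by
    have h := hA.spectral_theorem
    rw [Unitary.conjStarAlgAut_apply] at h
    have h' : Aᴴ * A = E * diagonal (fun i => (ev i : ℂ)) * Eᴴ := h
    rw [Matrix.conjTranspose_mul, Matrix.mul_assoc, ← Matrix.mul_assoc Aᴴ, h']
    calc Eᴴ * (E * diagonal (fun i => (ev i : ℂ)) * Eᴴ * E)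
        = (Eᴴ * E) * diagonal (fun i => (ev i : ℂ)) * (Eᴴ * E) := by
          simp only [Matrix.mul_assoc]
      _ = _ := by rw [hE1, Matrix.one_mul, Matrix.mul_one]
  have hzero : ∀ j, ev j = 0 → ∀ x, (A * E) x j = 0 := by
    intro j hj x
    have h := congrFun (congrFun hdiag j) j
    rw [Matrix.diagonal_apply_eq, hj, Matrix.mul_apply] at h
    have h2 : ∑ x, Complex.normSq ((A * E) x j) = 0 := by
      have h3 : ∑ x, (A * E)ᴴ j x * (A * E) x j =
          ((∑ x, Complex.normSq ((A * E) x j) : ℝ) : ℂ) := by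
        push_cast
        refine Finset.sum_congr rfl fun x _ => ?_
        rw [Matrix.conjTranspose_apply, Complex.normSq_eq_conj_mul_self]
        rfl
      rw [h3] at h
      exact_mod_cast h
    have h4 := (Finset.sum_eq_zero_iff_of_nonneg (fun x _ => Complex.normSq_nonneg _)).mp h2
    exact Complex.normSq_eq_zero.mp (h4 x (Finset.mem_univ x))
  let e := (Fintype.equivFin {i // ev i ≠ 0}).symm
  let D : Fin (Fintype.card {i // ev i ≠ 0}) → ℝ := fun j => Real.sqrt (ev (e j))
  have hD : ∀ j, 0 < D j := fun j => Real.sqrt_pos.mpr ((hnn _).lt_of_ne' (e j).2)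
  have hDne : ∀ j, (D j : ℂ) ≠ 0 := fun j => Complex.ofReal_ne_zero.mpr (hD j).ne'
  have hDsq : ∀ j, (ev (e j) : ℂ) = D j * D j := fun j => by
    rw [← Complex.ofReal_mul, Real.mul_self_sqrt (hnn _)]
  let V : Matrix (Fin b) (Fin (Fintype.card {i // ev i ≠ 0})) ℂ :=
    E.submatrix id (fun j => (e j : Fin b))
  have hAV : A * V = (A * E).submatrix id (fun j => (e j : Fin b)) := by
    ext x y
    simp [V, Matrix.mul_apply]
  have hVV : Vᴴ * V = 1 := by
    have : Vᴴ * V = (Eᴴ * E).submatrix (fun j => (e j : Fin b)) (fun j => (e j : Fin b)) := by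
      ext x y
      simp [V, Matrix.mul_apply]
    rw [this, hE1]
    exact Matrix.submatrix_one _ (Subtype.val_injective.comp e.injective)
  have hAVAV : (A * V)ᴴ * (A * V) = diagonal (fun j => (D j : ℂ) * D j) := by
    rw [hAV]
    have : ((A * E).submatrix id (fun j => (e j : Fin b)))ᴴ *
        (A * E).submatrix id (fun j => (e j : Fin b)) =
        ((A * E)ᴴ * (A * E)).submatrix (fun j => (e j : Fin b)) (fun j => (e j : Fin b)) := by
      ext x y
      simp [Matrix.mul_apply]
    rw [this, hdiag]
    refine (Matrix.submatrix_diagonal _ _ (Subtype.val_injective.comp e.injective)).trans ?_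
    congr 1
    funext j
    exact hDsq j
  have hAVV : A * V * Vᴴ = A := by
    have h1 : A = A * E * Eᴴ := by rw [Matrix.mul_assoc, hE2, Matrix.mul_one]
    conv_rhs => rw [h1]
    rw [hAV]
    ext x y
    let f : Fin b → ℂ := fun i => (A * E) x i * Eᴴ i y
    calc _ = ∑ j, f (e j) := rfl
      _ = ∑ i : {i // ev i ≠ 0}, f i := e.sum_comp (fun i : {i // ev i ≠ 0} => f i)
      _ = ∑ i ∈ Finset.univ.filter (fun i => ev i ≠ 0), f i :=
        (Finset.sum_subtype _ (by simp) f).symm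
      _ = ∑ i, f i := by
        refine Finset.sum_filter_of_ne fun i _ hi h0 => hi ?_
        simp only [f]
        rw [hzero i h0, zero_mul]
      _ = (A * E * Eᴴ) x y := rfl
  refine ⟨_, A * V * diagonal (fun j => (D j : ℂ)⁻¹), D, V, ?_, hVV, fun j => (hD j).le, ?_⟩
  · rw [Matrix.conjTranspose_mul, Matrix.diagonal_conjTranspose, Matrix.mul_assoc,
      ← Matrix.mul_assoc (A * V)ᴴ, hAVAV, Matrix.diagonal_mul_diagonal,
      Matrix.diagonal_mul_diagonal, ← Matrix.diagonal_one]
    congr 1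
    funext j
    have := hDne j
    simp
    field_simp
  · have : diagonal (fun j => (D j : ℂ)⁻¹) * diagonal (fun j => (D j : ℂ)) = 1 := by
      rw [Matrix.diagonal_mul_diagonal, ← Matrix.diagonal_one]
      congr 1
      funext j
      exact inv_mul_cancel₀ (hDne j)
    rw [Matrix.mul_assoc (A * V), this, Matrix.mul_one, hAVV]

/-- Every matrix has a generalized inverse `B` for which `B A` is the orthogonal projection onto
the orthogonal complement of the kernel. -/
theorem exists_generalizedInverse {a b : ℕ} (A : Matrix (Fin a) (Fin b) ℂ) :
    ∃ B : Matrix (Fin b) (Fin a) ℂ, A * B * A = A ∧ (B * A)ᴴ = B * A := by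
  obtain ⟨r, U, D, V, hU, hV, -, rfl⟩ := exists_isThinSVD A
  refine ⟨V * diagonal (fun i => (D i : ℂ)⁻¹) * Uᴴ, ?_, ?_⟩
  · calc U * diagonal (fun i => (D i : ℂ)) * Vᴴ * (V * diagonal (fun i => (D i : ℂ)⁻¹) * Uᴴ) *
          (U * diagonal (fun i => (D i : ℂ)) * Vᴴ)
        = U * (diagonal (fun i => (D i : ℂ)) * (Vᴴ * V) * diagonal (fun i => (D i : ℂ)⁻¹) *
            (Uᴴ * U) * diagonal (fun i => (D i : ℂ))) * Vᴴ := by simp only [Matrix.mul_assoc]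
      _ = U * diagonal (fun i => (D i : ℂ)) * Vᴴ := by
        rw [hU, hV, Matrix.mul_one, Matrix.mul_one, Matrix.diagonal_mul_diagonal,
          Matrix.diagonal_mul_diagonal]
        congr 3
        funext i
        exact mul_inv_mul_cancel _
  · have h : V * diagonal (fun i => (D i : ℂ)⁻¹) * Uᴴ * (U * diagonal (fun i => (D i : ℂ)) * Vᴴ)
        = V * diagonal (fun i => (((D i)⁻¹ * D i : ℝ) : ℂ)) * Vᴴ := by
      calc _ = V * (diagonal (fun i => (D i : ℂ)⁻¹) * (Uᴴ * U) * diagonal (fun i => (D i : ℂ))) *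
            Vᴴ := by simp only [Matrix.mul_assoc]
        _ = _ := by
          rw [hU, Matrix.mul_one, Matrix.diagonal_mul_diagonal]
          push_cast
          rfl
    rw [h, Matrix.conjTranspose_mul, Matrix.conjTranspose_mul, Matrix.diagonal_conjTranspose,
      Matrix.conjTranspose_conjTranspose, ← Matrix.mul_assoc]
    congr 3
    funext i
    exact Complex.conj_ofReal _

/-- A covariance `S` can be cut down to rank at most the number of receive antennas without
changing the received covariance `A S Aᴴ`. -/
theorem Matrix.PosSemidef.exists_rank_le {a b : ℕ} (A : Matrix (Fin a) (Fin b) ℂ)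
    {S : Matrix (Fin b) (Fin b) ℂ} (hS : S.PosSemidef) :
    ∃ S' : Matrix (Fin b) (Fin b) ℂ, S'.PosSemidef ∧ (S - S').PosSemidef ∧
      A * S' * Aᴴ = A * S * Aᴴ ∧ S'.rank ≤ a := by
  obtain ⟨R, rfl⟩ := hS.exists_eq_conjTranspose_mul_self
  obtain ⟨B, hB1, hB2⟩ := exists_generalizedInverse (A * Rᴴ)
  set X := A * Rᴴ with hX
  have hidem : B * X * (B * X) = B * X := by
    rw [Matrix.mul_assoc, ← Matrix.mul_assoc X, hB1]
  have h1 : Rᴴ * (B * X) * R = (B * X * R)ᴴ * (B * X * R) := by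
    rw [Matrix.conjTranspose_mul, hB2, Matrix.mul_assoc Rᴴ (B * X), Matrix.mul_assoc Rᴴ (B * X),
      ← Matrix.mul_assoc (B * X) (B * X) R, hidem]
  have h2 : Rᴴ * R - Rᴴ * (B * X) * R = ((1 - B * X) * R)ᴴ * ((1 - B * X) * R) := by
    have h3 : (1 - B * X)ᴴ * (1 - B * X) = 1 - B * X := by
      rw [Matrix.conjTranspose_sub, hB2, Matrix.conjTranspose_one, Matrix.mul_sub, Matrix.sub_mul,
        Matrix.sub_mul, hidem]
      simp
    rw [Matrix.conjTranspose_mul, Matrix.mul_assoc Rᴴ (1 - B * X)ᴴ,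
      ← Matrix.mul_assoc (1 - B * X)ᴴ, h3, Matrix.sub_mul, Matrix.mul_sub, Matrix.one_mul,
      Matrix.mul_assoc Rᴴ]
  refine ⟨Rᴴ * (B * X) * R, ?_, ?_, ?_, ?_⟩
  · rw [h1]
    exact Matrix.posSemidef_conjTranspose_mul_self _
  · rw [h2]
    exact Matrix.posSemidef_conjTranspose_mul_self _
  · calc A * (Rᴴ * (B * X) * R) * Aᴴ = (A * Rᴴ) * B * X * (R * Aᴴ) := by
          simp only [Matrix.mul_assoc]
      _ = X * (R * Aᴴ) := by rw [← hX, hB1]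
      _ = A * (Rᴴ * R) * Aᴴ := by rw [hX]; simp only [Matrix.mul_assoc]
  · have : Rᴴ * (B * X) * R = (Rᴴ * B) * (X * R) := by simp only [Matrix.mul_assoc]
    rw [this]
    calc _ ≤ (X * R).rank := (Matrix.rank_mul_le _ _).trans (min_le_right _ _)
      _ ≤ a := by simpa using Matrix.rank_le_card_height (X * R)

/-! ### The inverse square root -/

theorem spectrum_pos_of_posDef {d : ℕ} {A : Matrix (Fin d) (Fin d) ℂ} (hA : A.PosDef) {x : ℝ}
    (hx : x ∈ spectrum ℝ A) : 0 < x := by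
  rw [hA.1.spectrum_real_eq_range_eigenvalues] at hx
  obtain ⟨i, rfl⟩ := hx
  exact hA.eigenvalues_pos i

theorem invSqrt_conjTranspose {d : ℕ} (A : Matrix (Fin d) (Fin d) ℂ) :
    (invSqrt A)ᴴ = invSqrt A :=
  (cfc_predicate (p := IsSelfAdjoint) (fun x : ℝ => (Real.sqrt x)⁻¹) A :)

theorem invSqrt_mul_self_mul {d : ℕ} {A : Matrix (Fin d) (Fin d) ℂ} (hA : A.PosDef) :
    invSqrt A * invSqrt A * A = 1 := by
  have hsa : IsSelfAdjoint A := hA.1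
  have hfin : (spectrum ℝ A).Finite := Matrix.finite_real_spectrum
  have hc : ∀ f : ℝ → ℝ, ContinuousOn f (spectrum ℝ A) := fun f => hfin.continuousOn f
  calc invSqrt A * invSqrt A * A
      = cfc (fun x : ℝ => (Real.sqrt x)⁻¹ * (Real.sqrt x)⁻¹ * x) A := by
        rw [cfc_mul _ _ A (hc _) (hc _), cfc_mul _ _ A (hc _) (hc _), cfc_id' ℝ A, invSqrt]
    _ = cfc (fun _ : ℝ => (1 : ℝ)) A := by
        refine cfc_congr fun x hx => ?_
        have hx := spectrum_pos_of_posDef hA hx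
        have hs : Real.sqrt x * Real.sqrt x = x := Real.mul_self_sqrt hx.le
        rw [← mul_inv, hs]
        exact inv_mul_cancel₀ hx.ne'
    _ = 1 := cfc_const_one ℝ A

/-! ### Sum rates of parallel channels -/

theorem convex_psdTuples {K : ℕ} (b : Fin K → ℕ) : Convex ℝ (psdTuples b) := by
  intro S hS T hT x y hx hy _ k
  exact ((hS k).smul_real hx).add ((hT k).smul_real hy)

theorem convex_dualCovariances {K : ℕ} (b : Fin K → ℕ) (P : ℝ) :
    Convex ℝ (dualCovariances b P) := by
  intro S hS T hT x y hx hy hxy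
  refine ⟨convex_psdTuples b hS.1 hT.1 hx hy hxy, ?_⟩
  have h : ∑ k, ((x • S + y • T) k).trace.re =
      x * ∑ k, (S k).trace.re + y * ∑ k, (T k).trace.re := by
    simp [Finset.mul_sum, Finset.sum_add_distrib]
  rw [h]
  calc _ ≤ x * P + y * P := add_le_add (mul_le_mul_of_nonneg_left hS.2 hx)
        (mul_le_mul_of_nonneg_left hT.2 hy)
    _ = P := by rw [← add_mul, hxy, one_mul]

theorem zero_mem_dualCovariances {K : ℕ} (b : Fin K → ℕ) {P : ℝ} (hP : 0 ≤ P) :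
    (0 : (k : Fin K) → Matrix (Fin (b k)) (Fin (b k)) ℂ) ∈ dualCovariances b P :=
  ⟨fun _ => Matrix.PosSemidef.zero, by simpa using hP⟩

theorem dualCovariancesEq_subset {K : ℕ} (b : Fin K → ℕ) (P : ℝ) :
    dualCovariancesEq b P ⊆ dualCovariances b P :=
  fun _ h => ⟨h.1, h.2.le⟩

theorem smul_mem_psdTuples {K : ℕ} {b : Fin K → ℕ}
    {S : (k : Fin K) → Matrix (Fin (b k)) (Fin (b k)) ℂ} (hS : S ∈ psdTuples b) {t : ℝ}
    (ht : 0 ≤ t) : t • S ∈ psdTuples b :=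
  fun k => (hS k).smul_real ht

theorem sum_trace_smul {K : ℕ} {b : Fin K → ℕ} (t : ℝ)
    (S : (k : Fin K) → Matrix (Fin (b k)) (Fin (b k)) ℂ) :
    ∑ k, ((t • S) k).trace.re = t * ∑ k, (S k).trace.re := by
  simp [Finset.mul_sum]

theorem Matrix.PosSemidef.norm_apply_le {d : ℕ} {S : Matrix (Fin d) (Fin d) ℂ}
    (hS : S.PosSemidef) (i j : Fin d) : ‖S i j‖ ≤ S.trace.re := by
  obtain ⟨C, rfl⟩ := hS.exists_eq_conjTranspose_mul_self
  have hcol : ∀ j, ∑ x, ‖C x j‖ ^ 2 ≤ (Cᴴ * C).trace.re := by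
    intro j
    have h : (Cᴴ * C).trace.re = ∑ j, ∑ x, ‖C x j‖ ^ 2 := by
      simp only [Matrix.trace, Matrix.diag_apply, Matrix.mul_apply, Matrix.conjTranspose_apply,
        Complex.re_sum]
      refine Finset.sum_congr rfl fun j _ => Finset.sum_congr rfl fun x _ => ?_
      rw [← Complex.normSq_eq_norm_sq, ← Complex.ofReal_re (Complex.normSq _),
        Complex.normSq_eq_conj_mul_self]
      rfl
    rw [h]
    exact Finset.single_le_sum (f := fun j => ∑ x, ‖C x j‖ ^ 2)
      (fun j _ => Finset.sum_nonneg fun x _ => sq_nonneg _) (Finset.mem_univ j)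
  calc ‖(Cᴴ * C) i j‖ ≤ ∑ x, ‖C x i‖ * ‖C x j‖ := by
        rw [Matrix.mul_apply]
        refine (norm_sum_le _ _).trans (le_of_eq ?_)
        refine Finset.sum_congr rfl fun x _ => ?_
        rw [norm_mul, Matrix.conjTranspose_apply, norm_star]
    _ ≤ ∑ x, (‖C x i‖ ^ 2 + ‖C x j‖ ^ 2) / 2 :=
        Finset.sum_le_sum fun x _ => by nlinarith [sq_nonneg (‖C x i‖ - ‖C x j‖)]
    _ = (∑ x, ‖C x i‖ ^ 2 + ∑ x, ‖C x j‖ ^ 2) / 2 := by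
        rw [← Finset.sum_add_distrib, Finset.sum_div]
    _ ≤ (Cᴴ * C).trace.re := by linarith [hcol i, hcol j]

theorem isClosed_setOf_posSemidef (d : ℕ) :
    IsClosed {S : Matrix (Fin d) (Fin d) ℂ | S.PosSemidef} := by
  have h : {S : Matrix (Fin d) (Fin d) ℂ | S.PosSemidef} =
      {S | Sᴴ = S} ∩ ⋂ x : Fin d → ℂ, {S | 0 ≤ star x ⬝ᵥ (S *ᵥ x)} := by
    ext S
    simp [Matrix.posSemidef_iff_dotProduct_mulVec, Matrix.IsHermitian]
  rw [h]
  refine IsClosed.inter (isClosed_eq (by fun_prop) (by fun_prop))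
    (isClosed_iInter fun x => isClosed_le continuous_const ?_)
  exact Continuous.dotProduct continuous_const (Continuous.matrix_mulVec continuous_id
    continuous_const)

theorem isClosed_psdTuples {K : ℕ} (b : Fin K → ℕ) : IsClosed (psdTuples b) := by
  have h : psdTuples b = ⋂ k, (fun S : (k : Fin K) → Matrix (Fin (b k)) (Fin (b k)) ℂ => S k) ⁻¹'
      {S | S.PosSemidef} := by
    ext S
    simp [psdTuples]
  rw [h]
  exact isClosed_iInter fun k => (isClosed_setOf_posSemidef (b k)).preimage (continuous_apply k)

theorem isCompact_dualCovariances {K : ℕ} (b : Fin K → ℕ) (P : ℝ) :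
    IsCompact (dualCovariances b P) := by
  have hcpt : IsCompact (Set.univ.pi fun k : Fin K => (Set.univ.pi fun _ : Fin (b k) =>
      Set.univ.pi fun _ : Fin (b k) => Metric.closedBall (0 : ℂ) P :
        Set (Matrix (Fin (b k)) (Fin (b k)) ℂ))) :=
    isCompact_univ_pi fun k => isCompact_univ_pi fun _ => isCompact_univ_pi fun _ =>
      isCompact_closedBall _ _
  refine hcpt.of_isClosed_subset ?_ ?_
  · suffices hcont : Continuous fun S : (k : Fin K) → Matrix (Fin (b k)) (Fin (b k)) ℂ =>
        ∑ k, (S k).trace.re from (isClosed_psdTuples b).inter (isClosed_le hcont continuous_const)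
    refine continuous_finsetSum _ fun k _ => Complex.continuous_re.comp ?_
    exact (continuous_apply k).matrix_trace
  · intro S hS
    have hbound : ∀ k i j, ‖S k i j‖ ≤ P := fun k i j =>
      ((hS.1 k).norm_apply_le i j).trans <|
        (Finset.single_le_sum (f := fun k => Complex.re (Matrix.trace (S k)))
          (fun k _ => (hS.1 k).trace_re_nonneg) (Finset.mem_univ k)).trans hS.2
    exact fun k _ i _ j _ => mem_closedBall_zero_iff.mpr (hbound k i j)

/-- The sum rate `∑ₖ log det (1 + A_k S_k A_kᴴ)` of parallel channels `A_k` with input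
covariances `S_k`. -/
def logRate {K : ℕ} {a b : Fin K → ℕ} (A : (k : Fin K) → Matrix (Fin (a k)) (Fin (b k)) ℂ)
    (S : (k : Fin K) → Matrix (Fin (b k)) (Fin (b k)) ℂ) : ℝ :=
  ∑ k, Real.log (1 + A k * S k * (A k)ᴴ).det.re

section logRate

variable {K : ℕ} {a b : Fin K → ℕ} {A : (k : Fin K) → Matrix (Fin (a k)) (Fin (b k)) ℂ} {P : ℝ}

theorem posDef_one_add {m n : ℕ} (A : Matrix (Fin m) (Fin n) ℂ) {S : Matrix (Fin n) (Fin n) ℂ}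
    (hS : S.PosSemidef) : (1 + A * S * Aᴴ).PosDef :=
  Matrix.PosDef.one.add_posSemidef (hS.mul_mul_conjTranspose_same A)

theorem continuousOn_logRate : ContinuousOn (logRate A) (psdTuples b) := by
  refine continuousOn_finsetSum _ fun k _ => ContinuousOn.log ?_ fun S hS =>
    (posDef_one_add (A k) (hS k)).det_re_pos.ne'
  refine (Complex.continuous_re.comp (Continuous.matrix_det ?_)).continuousOn
  exact continuous_const.add ((continuous_const.matrix_mul (continuous_apply k)).matrix_mul
    continuous_const)

theorem exists_max_logRate (hP : 0 ≤ P) :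
    ∃ S ∈ dualCovariances b P, ∀ T ∈ dualCovariances b P, logRate A T ≤ logRate A S :=
  (isCompact_dualCovariances b P).exists_isMaxOn ⟨0, zero_mem_dualCovariances b hP⟩
    (continuousOn_logRate.mono fun _ h => h.1)

theorem logRate_concave {S T : (k : Fin K) → Matrix (Fin (b k)) (Fin (b k)) ℂ}
    (hS : S ∈ psdTuples b) (hT : T ∈ psdTuples b) {x y : ℝ} (hx : 0 ≤ x) (hy : 0 ≤ y)
    (hxy : x + y = 1) :
    x * logRate A S + y * logRate A T ≤ logRate A (x • S + y • T) ∧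
      (0 < x → 0 < y → x * logRate A S + y * logRate A T = logRate A (x • S + y • T) →
        ∀ k, A k * S k * (A k)ᴴ = A k * T k * (A k)ᴴ) := by
  have hk := fun k => (posDef_one_add (A k) (hS k)).log_det_concave (posDef_one_add (A k) (hT k))
    hx hy hxy
  have hcomb : ∀ k, x • (1 + A k * S k * (A k)ᴴ) + y • (1 + A k * T k * (A k)ᴴ) =
      1 + A k * (x • S + y • T) k * (A k)ᴴ := by
    intro k
    have h1 : (1 : Matrix (Fin (a k)) (Fin (a k)) ℂ) = x • 1 + y • 1 := by
      rw [← add_smul, hxy, one_smul]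
    conv_rhs => rw [h1]
    simp only [Pi.add_apply, Pi.smul_apply, Matrix.mul_add, Matrix.add_mul, Matrix.mul_smul,
      Matrix.smul_mul, smul_add]
    abel
  have hle : ∀ k ∈ Finset.univ, x * Real.log (1 + A k * S k * (A k)ᴴ).det.re +
      y * Real.log (1 + A k * T k * (A k)ᴴ).det.re ≤
      Real.log (1 + A k * (x • S + y • T) k * (A k)ᴴ).det.re := fun k _ => by
    rw [← hcomb k]; exact (hk k).1
  have hsum : x * logRate A S + y * logRate A T =
      ∑ k, (x * Real.log (1 + A k * S k * (A k)ᴴ).det.re +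
        y * Real.log (1 + A k * T k * (A k)ᴴ).det.re) := by
    simp only [logRate, Finset.mul_sum, Finset.sum_add_distrib]
  rw [hsum]
  refine ⟨Finset.sum_le_sum hle, fun hx' hy' h k => ?_⟩
  have h1 := (Finset.sum_eq_sum_iff_of_le hle).mp h k (Finset.mem_univ k)
  rw [← hcomb k] at h1
  exact add_left_cancel ((hk k).2 hx' hy' h1)

/-- Unused power can always be spent, and doing so strictly increases the rate. -/
theorem exists_full_power {k₀ : Fin K} (hA : A k₀ ≠ 0)
    {S : (k : Fin K) → Matrix (Fin (b k)) (Fin (b k)) ℂ} (hS : S ∈ dualCovariances b P) :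
    ∃ T ∈ dualCovariancesEq b P, logRate A S ≤ logRate A T ∧
      (∑ k, (S k).trace.re < P → logRate A S < logRate A T) := by
  have hb : 0 < b k₀ := by
    rcases Nat.eq_zero_or_pos (b k₀) with h | h
    · exfalso
      refine hA ?_
      ext i j
      exact (Fin.cast h j).elim0
    · exact h
  have hbR : (0 : ℝ) < b k₀ := by exact_mod_cast hb
  set t := ∑ k, (S k).trace.re with ht
  set ε := (P - t) / b k₀ with hε
  have hε0 : 0 ≤ ε := div_nonneg (sub_nonneg.mpr hS.2) hbR.le
  let δ : Fin K → ℝ := fun k => if k = k₀ then ε else 0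
  have hδ : ∀ k, 0 ≤ δ k := fun k => by
    by_cases h : k = k₀ <;> simp [δ, h, hε0]
  let T : (k : Fin K) → Matrix (Fin (b k)) (Fin (b k)) ℂ := fun k => S k + δ k • 1
  have hmono : ∀ k, Real.log (1 + A k * S k * (A k)ᴴ).det.re ≤
      Real.log (1 + A k * T k * (A k)ᴴ).det.re ∧
      (Real.log (1 + A k * S k * (A k)ᴴ).det.re = Real.log (1 + A k * T k * (A k)ᴴ).det.re →
        δ k • (A k * (A k)ᴴ) = 0) := by
    intro k
    have hdiff : 1 + A k * T k * (A k)ᴴ - (1 + A k * S k * (A k)ᴴ) = δ k • (A k * (A k)ᴴ) := by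
      simp [T, Matrix.mul_add, Matrix.add_mul]
    have hpsd : (1 + A k * T k * (A k)ᴴ - (1 + A k * S k * (A k)ᴴ)).PosSemidef := by
      rw [hdiff]
      exact (Matrix.posSemidef_self_mul_conjTranspose (A k)).smul_real (hδ k)
    obtain ⟨h1, h2⟩ := (posDef_one_add (A k) (hS.1 k)).log_det_mono hpsd
    exact ⟨h1, fun h => by rw [← hdiff, ← h2 h, sub_self]⟩
  refine ⟨T, ⟨fun k => (hS.1 k).add (Matrix.PosSemidef.one.smul_real (hδ k)), ?_⟩,
    Finset.sum_le_sum fun k _ => (hmono k).1, fun hlt => ?_⟩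
  · have : ∀ k, (T k).trace.re = (S k).trace.re + δ k * b k := fun k => by simp [T]
    simp only [this, Finset.sum_add_distrib, δ, ite_mul, zero_mul, Finset.sum_ite_eq',
      Finset.mem_univ, if_true]
    rw [← ht, hε, div_mul_cancel₀ _ hbR.ne']
    ring
  · refine Finset.sum_lt_sum (fun k _ => (hmono k).1) ⟨k₀, Finset.mem_univ _, ?_⟩
    refine lt_of_le_of_ne (hmono k₀).1 fun h => hA ?_
    have h1 := (hmono k₀).2 h
    have hε' : δ k₀ ≠ 0 := by
      have h2 : δ k₀ = ε := if_pos rfl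
      rw [h2]
      exact (div_pos (sub_pos.mpr hlt) hbR).ne'
    exact Matrix.self_mul_conjTranspose_eq_zero.mp ((smul_eq_zero.mp h1).resolve_left hε')

theorem trace_eq_of_max {k₀ : Fin K} (hA : A k₀ ≠ 0)
    {S : (k : Fin K) → Matrix (Fin (b k)) (Fin (b k)) ℂ} (hS : S ∈ dualCovariances b P)
    (hmax : ∀ T ∈ dualCovariances b P, logRate A T ≤ logRate A S) :
    ∑ k, (S k).trace.re = P := by
  by_contra hne
  obtain ⟨T, hT, -, h⟩ := exists_full_power hA hS
  exact (h (lt_of_le_of_ne hS.2 hne)).not_ge (hmax T (dualCovariancesEq_subset b P hT))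

/-- A maximizer wastes no power outside the row spaces of the channels, so that it can be computed
from the received covariances with the generalized inverses `B k`. Otherwise compressing `S` by the
projections `B A` would keep the rate and save power. -/
theorem eq_projection_of_max {k₀ : Fin K} (hA : A k₀ ≠ 0)
    {B : (k : Fin K) → Matrix (Fin (b k)) (Fin (a k)) ℂ} (hB : ∀ k, A k * B k * A k = A k)
    (hBA : ∀ k, (B k * A k)ᴴ = B k * A k)
    {S : (k : Fin K) → Matrix (Fin (b k)) (Fin (b k)) ℂ} (hS : S ∈ dualCovariances b P)
    (hmax : ∀ T ∈ dualCovariances b P, logRate A T ≤ logRate A S) (k : Fin K) :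
    S k = B k * (A k * S k * (A k)ᴴ) * (B k)ᴴ := by
  let T : (k : Fin K) → Matrix (Fin (b k)) (Fin (b k)) ℂ :=
    fun k => (B k * A k) * S k * (B k * A k)ᴴ
  have hTpsd : T ∈ psdTuples b := fun k => (hS.1 k).mul_mul_conjTranspose_same _
  have hrate : logRate A T = logRate A S := by
    unfold logRate
    refine Finset.sum_congr rfl fun k _ => ?_
    have : A k * T k * (A k)ᴴ = A k * S k * (A k)ᴴ := by
      calc A k * T k * (A k)ᴴ = (A k * B k * A k) * S k * (A k * B k * A k)ᴴ := by
            simp only [T, Matrix.conjTranspose_mul, Matrix.mul_assoc]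
        _ = _ := by rw [hB k]
    rw [this]
  have hidem : ∀ k, B k * A k * (B k * A k) = B k * A k := fun k => by
    rw [Matrix.mul_assoc, ← Matrix.mul_assoc (A k), hB k]
  have hidem' : ∀ k, (1 - B k * A k) * (1 - B k * A k) = 1 - B k * A k := fun k => by
    rw [Matrix.mul_sub, Matrix.sub_mul, Matrix.sub_mul, hidem k]
    simp
  have hherm' : ∀ k, (1 - B k * A k)ᴴ = 1 - B k * A k := fun k => by
    rw [Matrix.conjTranspose_sub, hBA k, Matrix.conjTranspose_one]
  let R : (k : Fin K) → Matrix (Fin (b k)) (Fin (b k)) ℂ :=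
    fun k => (1 - B k * A k) * S k * (1 - B k * A k)ᴴ
  have hRpsd : ∀ k, (R k).PosSemidef := fun k => (hS.1 k).mul_mul_conjTranspose_same _
  have htr : ∀ k, (S k).trace.re = (T k).trace.re + (R k).trace.re := fun k => by
    have h1 : (T k).trace = (B k * A k * S k).trace := by
      simp only [T]
      rw [hBA k, Matrix.trace_mul_cycle, hidem k]
    have h2 : (R k).trace = ((1 - B k * A k) * S k).trace := by
      simp only [R]
      rw [hherm' k, Matrix.trace_mul_cycle, hidem' k]
    rw [h1, h2, ← Complex.add_re, ← Matrix.trace_add, ← Matrix.add_mul, add_sub_cancel,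
      Matrix.one_mul]
  have hsum : ∑ k, (S k).trace.re = ∑ k, (T k).trace.re + ∑ k, (R k).trace.re := by
    rw [← Finset.sum_add_distrib]
    exact Finset.sum_congr rfl fun k _ => htr k
  have hRsum : 0 ≤ ∑ k, (R k).trace.re := Finset.sum_nonneg fun k _ => (hRpsd k).trace_re_nonneg
  have hTmem : T ∈ dualCovariances b P := ⟨hTpsd, by linarith [hS.2]⟩
  have hS' := trace_eq_of_max hA hS hmax
  have hT' := trace_eq_of_max hA hTmem fun U hU => hrate ▸ hmax U hU
  have hR0 : (R k).trace.re = 0 :=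
    (Finset.sum_eq_zero_iff_of_nonneg fun k _ => (hRpsd k).trace_re_nonneg).mp
      (by linarith) k (Finset.mem_univ k)
  have hR : R k = 0 := (hRpsd k).eq_zero_of_trace_re hR0
  -- `S = Cᴴ C`, and `C (1 - B A) = 0` because `R = (1 - B A) Cᴴ C (1 - B A) = 0`
  obtain ⟨C, hC⟩ := (hS.1 k).exists_eq_conjTranspose_mul_self
  have h0 : C * (1 - B k * A k)ᴴ = 0 := by
    refine Matrix.conjTranspose_mul_self_eq_zero.mp ?_
    rw [Matrix.conjTranspose_mul, Matrix.conjTranspose_conjTranspose, ← hR]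
    simp only [R, hC, Matrix.mul_assoc]
  have h1 : C = C * (B k * A k)ᴴ := by
    rw [hherm' k, Matrix.mul_sub, Matrix.mul_one, sub_eq_zero] at h0
    rw [hBA k, ← h0]
  calc S k = Cᴴ * C := hC
    _ = (C * (B k * A k)ᴴ)ᴴ * (C * (B k * A k)ᴴ) := by rw [← h1]
    _ = B k * (A k * (Cᴴ * C) * (A k)ᴴ) * (B k)ᴴ := by
      simp only [Matrix.conjTranspose_mul, Matrix.conjTranspose_conjTranspose, Matrix.mul_assoc]
    _ = _ := by rw [← hC]

/-- The rate maximizing covariances are unique. By strict concavity of `log det` two maximizers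
agree at the receivers, and a maximizer is determined by the received covariances. -/
theorem max_unique {k₀ : Fin K} (hA : A k₀ ≠ 0)
    {S T : (k : Fin K) → Matrix (Fin (b k)) (Fin (b k)) ℂ}
    (hS : S ∈ dualCovariances b P) (hSmax : ∀ R ∈ dualCovariances b P, logRate A R ≤ logRate A S)
    (hT : T ∈ dualCovariances b P) (hTS : logRate A S ≤ logRate A T) : S = T := by
  have hTmax : ∀ R ∈ dualCovariances b P, logRate A R ≤ logRate A T :=
    fun R hR => (hSmax R hR).trans hTS
  have heq : logRate A S = logRate A T := hTS.antisymm (hSmax T hT)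
  choose B hB hBA using fun k => exists_generalizedInverse (A k)
  have hhalf : (0 : ℝ) < 1 / 2 := by norm_num
  have hone : (1 / 2 : ℝ) + 1 / 2 = 1 := by norm_num
  obtain ⟨h1, h2⟩ := logRate_concave (A := A) hS.1 hT.1 hhalf.le hhalf.le hone
  have h3 := hSmax _ (convex_dualCovariances b P hS hT hhalf.le hhalf.le hone)
  have h4 := h2 hhalf hhalf (le_antisymm h1 (by linarith))
  funext k
  rw [eq_projection_of_max hA hB hBA hS hSmax k, h4 k,
    ← eq_projection_of_max hA hB hBA hT hTmax k]

/-- The point-to-point duality map `Q ↦ W Uᴴ Q U Wᴴ` given by singular value decompositions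
`A = U D Wᴴ` turns covariances for the reversed channels `Aᴴ` into covariances for `A`, with the
same rate and no more power. -/
theorem dual_covariance {r : Fin K → ℕ} {U : (k : Fin K) → Matrix (Fin (a k)) (Fin (r k)) ℂ}
    {D : (k : Fin K) → Fin (r k) → ℝ} {W : (k : Fin K) → Matrix (Fin (b k)) (Fin (r k)) ℂ}
    (hsvd : ∀ k, IsThinSVD (A k) (U k) (D k) (W k))
    {Q : (k : Fin K) → Matrix (Fin (a k)) (Fin (a k)) ℂ} (hQ : Q ∈ dualCovariances a P) :
    (fun k => W k * (U k)ᴴ * Q k * U k * (W k)ᴴ) ∈ dualCovariances b P ∧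
      logRate A (fun k => W k * (U k)ᴴ * Q k * U k * (W k)ᴴ) =
        logRate (fun k => (A k)ᴴ) Q := by
  have hform : ∀ k, W k * (U k)ᴴ * Q k * U k * (W k)ᴴ = (W k * (U k)ᴴ) * Q k * (W k * (U k)ᴴ)ᴴ :=
    fun k => by simp only [Matrix.conjTranspose_mul, Matrix.conjTranspose_conjTranspose,
      Matrix.mul_assoc]
  refine ⟨⟨fun k => ?_, ?_⟩, ?_⟩
  · simp only [hform k]
    exact (hQ.1 k).mul_mul_conjTranspose_same _
  · refine le_trans (Finset.sum_le_sum fun k _ => ?_) hQ.2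
    obtain ⟨hU, hW, -, -⟩ := hsvd k
    have h1 : (W k * (U k)ᴴ * Q k * U k * (W k)ᴴ).trace = (U k * (U k)ᴴ * Q k).trace := by
      calc _ = (W k * ((U k)ᴴ * Q k * U k) * (W k)ᴴ).trace := by simp only [Matrix.mul_assoc]
        _ = ((U k)ᴴ * Q k * U k).trace := by
          rw [Matrix.trace_mul_cycle, hW, Matrix.one_mul]
        _ = _ := by rw [Matrix.trace_mul_cycle]
    have h2 : (1 - U k * (U k)ᴴ).PosSemidef := by
      have h : 1 - U k * (U k)ᴴ = (1 - U k * (U k)ᴴ)ᴴ * (1 - U k * (U k)ᴴ) := by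
        have h3 : U k * (U k)ᴴ * (U k * (U k)ᴴ) = U k * (U k)ᴴ := by
          rw [Matrix.mul_assoc, ← Matrix.mul_assoc (U k)ᴴ, hU, Matrix.one_mul]
        rw [Matrix.conjTranspose_sub, Matrix.conjTranspose_one, Matrix.conjTranspose_mul,
          Matrix.conjTranspose_conjTranspose, Matrix.mul_sub, Matrix.sub_mul, Matrix.sub_mul, h3]
        simp
      rw [h]
      exact Matrix.posSemidef_conjTranspose_mul_self _
    have h4 := h2.trace_mul_re_nonneg (hQ.1 k)
    rw [Matrix.sub_mul, Matrix.one_mul, Matrix.trace_sub, Complex.sub_re] at h4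
    simp only [h1]
    linarith
  · unfold logRate
    refine Finset.sum_congr rfl fun k _ => ?_
    obtain ⟨hU, hW, -, hA⟩ := hsvd k
    set Δ : Matrix (Fin (r k)) (Fin (r k)) ℂ := diagonal fun i => (D k i : ℂ) with hΔ
    have hΔH : Δᴴ = Δ := by
      rw [hΔ, Matrix.diagonal_conjTranspose]
      congr 1
      funext i
      exact Complex.conj_ofReal _
    set X := (U k)ᴴ * Q k * U k with hX
    have e1 : A k * (W k * (U k)ᴴ * Q k * U k * (W k)ᴴ) * (A k)ᴴ = U k * (Δ * X * Δ * (U k)ᴴ) := by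
      calc _ = U k * Δ * ((W k)ᴴ * W k) * X * ((W k)ᴴ * W k) * Δᴴ * (U k)ᴴ := by
            rw [hA]
            simp only [hX, Matrix.conjTranspose_mul, Matrix.conjTranspose_conjTranspose,
              Matrix.mul_assoc]
        _ = _ := by
            rw [hW, hΔH, Matrix.mul_one, Matrix.mul_one]
            simp only [Matrix.mul_assoc]
    have e2 : (A k)ᴴ * Q k * (A k)ᴴᴴ = W k * (Δ * X * Δ * (W k)ᴴ) := by
      rw [Matrix.conjTranspose_conjTranspose]
      conv_lhs => rw [hA]
      simp only [hX, Matrix.conjTranspose_mul, Matrix.conjTranspose_conjTranspose, hΔH,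
        Matrix.mul_assoc]
    rw [e1, e2, Matrix.det_one_add_mul_comm (U k), Matrix.det_one_add_mul_comm (W k),
      Matrix.mul_assoc _ (U k)ᴴ, Matrix.mul_assoc _ (W k)ᴴ, hU, hW]

theorem exists_dual_covariance (A : (k : Fin K) → Matrix (Fin (a k)) (Fin (b k)) ℂ)
    {Q : (k : Fin K) → Matrix (Fin (a k)) (Fin (a k)) ℂ} (hQ : Q ∈ dualCovariances a P) :
    ∃ S ∈ dualCovariances b P, logRate A S = logRate (fun k => (A k)ᴴ) Q := by
  choose r U D W h using fun k => exists_isThinSVD (A k)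
  exact ⟨_, (dual_covariance h hQ).1, (dual_covariance h hQ).2⟩

theorem exists_dual_covariance' (A : (k : Fin K) → Matrix (Fin (a k)) (Fin (b k)) ℂ)
    {S : (k : Fin K) → Matrix (Fin (b k)) (Fin (b k)) ℂ} (hS : S ∈ dualCovariances b P) :
    ∃ Q ∈ dualCovariances a P, logRate (fun k => (A k)ᴴ) Q = logRate A S := by
  simpa using exists_dual_covariance (fun k => (A k)ᴴ) hS

end logRate

/-! ### Priced constraints and the whitened channels -/

namespace CRNetwork

variable {K M N : ℕ} {n nb : Fin K → ℕ} {nt : Fin M → ℕ} {c : CRNetwork K M N n nb nt}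
  {ψ : Fin N ⊕ Fin M → ℝ} {P : ℝ}

/-- The left-hand sides of the power and interference constraints, as one vector. -/
def usage (c : CRNetwork K M N n nb nt) (S : (k : Fin K) → Matrix (Fin (nb k)) (Fin (nb k)) ℂ) :
    Fin N ⊕ Fin M → ℝ :=
  Sum.elim (fun i => ∑ k, ((c.V k * S k * (c.V k)ᴴ) i i).re)
    (fun m => ∑ k, (c.Gtilde m k * S k * (c.Gtilde m k)ᴴ).trace.re)

theorem mem_relaxedFeasible_iff {S : (k : Fin K) → Matrix (Fin (nb k)) (Fin (nb k)) ℂ} :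
    S ∈ c.relaxedFeasible ↔ S ∈ psdTuples nb ∧ ∀ i, c.usage S i ≤ c.limits i := by
  simp only [relaxedFeasible, psdTuples, Set.mem_ofPred_eq, Sum.forall, usage, limits,
    Sum.elim_inl, Sum.elim_inr]

theorem usage_combo (x y : ℝ) (S T : (k : Fin K) → Matrix (Fin (nb k)) (Fin (nb k)) ℂ) :
    c.usage (x • S + y • T) = x • c.usage S + y • c.usage T := by
  ext (i | m) <;>
  simp [usage, Matrix.mul_add, Matrix.add_mul, Finset.sum_add_distrib, Finset.mul_sum]

theorem usage_zero : c.usage 0 = 0 := by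
  ext (i | m) <;> simp [usage]

theorem usage_mono {S T : (k : Fin K) → Matrix (Fin (nb k)) (Fin (nb k)) ℂ}
    (h : ∀ k, (T k - S k).PosSemidef) (i : Fin N ⊕ Fin M) : c.usage S i ≤ c.usage T i := by
  rcases i with i | m
  · change ∑ k, ((c.V k * S k * (c.V k)ᴴ) i i).re ≤ ∑ k, ((c.V k * T k * (c.V k)ᴴ) i i).re
    refine Finset.sum_le_sum fun k _ => ?_
    have h1 := ((h k).mul_mul_conjTranspose_same (c.V k)).diag_nonneg (i := i)
    have h2 := (Complex.nonneg_iff.mp h1).1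
    rw [Matrix.mul_sub, Matrix.sub_mul, Matrix.sub_apply, Complex.sub_re] at h2
    linarith
  · change ∑ k, (c.Gtilde m k * S k * (c.Gtilde m k)ᴴ).trace.re ≤
      ∑ k, (c.Gtilde m k * T k * (c.Gtilde m k)ᴴ).trace.re
    refine Finset.sum_le_sum fun k _ => ?_
    have h2 := ((h k).mul_mul_conjTranspose_same (c.Gtilde m k)).trace_re_nonneg
    rw [Matrix.mul_sub, Matrix.sub_mul, Matrix.trace_sub, Complex.sub_re] at h2
    linarith

theorem Omega_combo (x y : ℝ) (ψ φ : Fin N ⊕ Fin M → ℝ) (k : Fin K) :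
    c.Omega (x • ψ + y • φ) k = x • c.Omega ψ k + y • c.Omega φ k := by
  have h : c.Lam (x • ψ + y • φ) = x • c.Lam ψ + y • c.Lam φ := by
    ext i j
    simp only [Lam, Matrix.add_apply, Matrix.smul_apply, Matrix.sum_apply, Pi.add_apply,
      Pi.smul_apply, smul_eq_mul, Complex.ofReal_add, Complex.ofReal_mul, Matrix.diagonal_apply,
      smul_add, Finset.smul_sum, Complex.real_smul, add_mul, Finset.sum_add_distrib, mul_assoc]
    split_ifs
    · ring
    · ring
  simp only [Omega, h, Matrix.mul_add, Matrix.add_mul, Matrix.mul_smul, Matrix.smul_mul]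

theorem Omega_smul (x : ℝ) (ψ : Fin N ⊕ Fin M → ℝ) (k : Fin K) :
    c.Omega (x • ψ) k = x • c.Omega ψ k := by
  simpa using Omega_combo (c := c) x 0 ψ 0 k

theorem Omega_zero (k : Fin K) : c.Omega 0 k = 0 := by
  simpa using Omega_smul (c := c) 0 0 k

/-- The multipliers price the resource usage: `∑ₖ tr (Ω_k S_k) = ψᵀ (usage of S)`. -/
theorem sum_trace_Omega_mul (ψ : Fin N ⊕ Fin M → ℝ)
    (S : (k : Fin K) → Matrix (Fin (nb k)) (Fin (nb k)) ℂ) :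
    ∑ k, (c.Omega ψ k * S k).trace.re = ψ ⬝ᵥ c.usage S := by
  have hk : ∀ k, (c.Omega ψ k * S k).trace.re =
      ∑ i, ψ (Sum.inl i) * ((c.V k * S k * (c.V k)ᴴ) i i).re +
        ∑ m, ψ (Sum.inr m) * (c.Gtilde m k * S k * (c.Gtilde m k)ᴴ).trace.re := by
    intro k
    have h1 : (c.Omega ψ k * S k).trace = (c.Lam ψ * (c.V k * S k * (c.V k)ᴴ)).trace := by
      rw [Omega, Matrix.mul_assoc, Matrix.mul_assoc, Matrix.trace_mul_comm]
      simp only [Matrix.mul_assoc]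
    have h2 : ∀ m, ((c.G m)ᴴ * c.G m * (c.V k * S k * (c.V k)ᴴ)).trace =
        (c.Gtilde m k * S k * (c.Gtilde m k)ᴴ).trace := by
      intro m
      rw [Matrix.mul_assoc, Matrix.trace_mul_comm, Gtilde]
      simp only [Matrix.conjTranspose_mul, Matrix.mul_assoc]
    rw [h1, Lam, Matrix.add_mul, Matrix.trace_add, Complex.add_re, Finset.sum_mul,
      Matrix.trace_sum, Complex.re_sum]
    congr 1
    · rw [Matrix.trace, Complex.re_sum]
      refine Finset.sum_congr rfl fun i _ => ?_
      rw [Matrix.diag_apply, Matrix.diagonal_mul, Complex.re_ofReal_mul]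
    · refine Finset.sum_congr rfl fun m _ => ?_
      rw [Matrix.smul_mul, Matrix.trace_smul, h2, smul_eq_mul, Complex.re_ofReal_mul]
  simp only [hk, Finset.sum_add_distrib, dotProduct, Fintype.sum_sum_type, usage, Sum.elim_inl,
    Sum.elim_inr, Finset.mul_sum]
  rw [Finset.sum_comm, Finset.sum_comm (s := (Finset.univ : Finset (Fin K)))
    (t := (Finset.univ : Finset (Fin M)))]

theorem Lam_posSemidef (hψ : ∀ i, 0 ≤ ψ i) : (c.Lam ψ).PosSemidef := by
  refine (Matrix.PosSemidef.diagonal fun i => ?_).add (Matrix.posSemidef_sum _ fun m _ => ?_)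
  · exact Complex.zero_le_real.mpr (hψ _)
  · exact (Matrix.posSemidef_conjTranspose_mul_self (c.G m)).smul (Complex.zero_le_real.mpr (hψ _))

theorem Omega_posSemidef (hψ : ∀ i, 0 ≤ ψ i) (k : Fin K) : (c.Omega ψ k).PosSemidef :=
  (Lam_posSemidef hψ).conjTranspose_mul_mul_same (c.V k)

theorem mem_dualDomain_of_pos (hV : c.IsZeroForcing) (hψ : ∀ i, 0 < ψ i) :
    ψ ∈ c.dualDomain := by
  refine ⟨fun i => (hψ i).le, fun k => ?_⟩
  have hL : (c.Lam ψ).PosDef :=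
    (Matrix.PosDef.diagonal fun i => Complex.zero_lt_real.mpr (hψ _)).add_posSemidef
      (Matrix.posSemidef_sum _ fun m _ => (Matrix.posSemidef_conjTranspose_mul_self (c.G m)).smul
        (Complex.zero_le_real.mpr (hψ _).le))
  exact hL.conjTranspose_mul_mul_same (Matrix.mulVec_injective_iff.mpr (hV k).1)

theorem add_mem_dualDomain {φ : Fin N ⊕ Fin M → ℝ} (hψ : ∀ i, 0 ≤ ψ i) (hφ : φ ∈ c.dualDomain)
    {x y : ℝ} (hx : 0 ≤ x) (hy : 0 < y) : x • ψ + y • φ ∈ c.dualDomain := by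
  refine ⟨fun i => add_nonneg (mul_nonneg hx (hψ i)) (mul_nonneg hy.le (hφ.1 i)), fun k => ?_⟩
  rw [Omega_combo]
  exact Matrix.PosDef.posSemidef_add ((Omega_posSemidef hψ k).smul_real hx)
    ((hφ.2 k).smul_real hy)

theorem smul_mem_dualDomain (hψ : ψ ∈ c.dualDomain) {x : ℝ} (hx : 0 < x) :
    x • ψ ∈ c.dualDomain := by
  simpa using add_mem_dualDomain (c := c) (ψ := 0) (fun _ => le_rfl) hψ le_rfl hx

theorem convex_dualDomain : Convex ℝ c.dualDomain := by
  intro ψ hψ φ hφ x y hx hy hxy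
  rcases hy.eq_or_lt with rfl | hy
  · have : x = 1 := by linarith
    simpa [this] using hψ
  · exact add_mem_dualDomain hψ.1 hφ hx hy

theorem convex_dualMultipliers : Convex ℝ (c.dualMultipliers P) := by
  intro ψ hψ φ hφ x y hx hy hxy
  refine ⟨convex_dualDomain hψ.1 hφ.1 hx hy hxy, ?_⟩
  rw [dotProduct_add, dotProduct_smul, dotProduct_smul, smul_eq_mul, smul_eq_mul]
  calc _ ≤ x * P + y * P := add_le_add (mul_le_mul_of_nonneg_left hψ.2 hx)
        (mul_le_mul_of_nonneg_left hφ.2 hy)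
    _ = P := by rw [← add_mul, hxy, one_mul]

/-- The dual objective is convex in the multipliers: `Ω_k` is linear in `ψ`, so the gradient
inequality for `Ω ↦ log det (Ω + B) - log det Ω` gives a supporting affine function at each
point. -/
theorem convexOn_dualObjective {Q : (k : Fin K) → Matrix (Fin (n k)) (Fin (n k)) ℂ}
    (hQ : Q ∈ psdTuples n) : ConvexOn ℝ c.dualDomain (fun ψ => c.dualObjective ψ Q) := by
  refine ⟨convex_dualDomain, fun ψ hψ φ hφ x y hx hy hxy => ?_⟩
  have hz := convex_dualDomain hψ hφ hx hy hxy
  simp only [dualObjective, smul_eq_mul, Finset.mul_sum]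
  rw [← Finset.sum_add_distrib]
  refine Finset.sum_le_sum fun k _ => ?_
  obtain ⟨R, hR⟩ := (hz.2 k).exists_subgradient
    ((hQ k).conjTranspose_mul_mul_same (c.Htilde k))
  have h1 := mul_le_mul_of_nonneg_left (hR _ (hψ.2 k)) hx
  have h2 := mul_le_mul_of_nonneg_left (hR _ (hφ.2 k)) hy
  have h3 : x * (R * (c.Omega ψ k - c.Omega (x • ψ + y • φ) k)).trace.re +
      y * (R * (c.Omega φ k - c.Omega (x • ψ + y • φ) k)).trace.re = 0 := by
    have h4 : x • (c.Omega ψ k - c.Omega (x • ψ + y • φ) k) +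
        y • (c.Omega φ k - c.Omega (x • ψ + y • φ) k) = 0 := by
      rw [smul_sub, smul_sub, sub_add_sub_comm, ← Omega_combo, ← add_smul, hxy, one_smul, sub_self]
    have h5 := congrArg (fun Z => (R * Z).trace.re) h4
    simpa only [Matrix.mul_add, Matrix.mul_smul, Matrix.trace_add, Matrix.trace_smul,
      Complex.add_re, Complex.smul_re, smul_eq_mul, Matrix.mul_zero, Matrix.trace_zero,
      Complex.zero_re] using h5
  have h6 : ∀ w : ℝ, w = x * w + y * w := fun w => by rw [← add_mul, hxy, one_mul]
  rw [h6 (Real.log ((c.Omega (x • ψ + y • φ) k + (c.Htilde k)ᴴ * Q k * c.Htilde k).det.re /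
    (c.Omega (x • ψ + y • φ) k).det.re))]
  rw [mul_sub] at h1 h2
  linarith

/-- The channels `H_k V_k Ω_k^{-1/2}` whitened by the multipliers. -/
def whitened (c : CRNetwork K M N n nb nt) (ψ : Fin N ⊕ Fin M → ℝ) (k : Fin K) :
    Matrix (Fin (n k)) (Fin (nb k)) ℂ :=
  c.Htilde k * invSqrt (c.Omega ψ k)

theorem dualObjective_eq_logRate (hψ : ψ ∈ c.dualDomain)
    {Q : (k : Fin K) → Matrix (Fin (n k)) (Fin (n k)) ℂ} (hQ : Q ∈ psdTuples n) :
    c.dualObjective ψ Q = logRate (fun k => (c.whitened ψ k)ᴴ) Q := by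
  unfold dualObjective logRate
  refine Finset.sum_congr rfl fun k _ => ?_
  set T := invSqrt (c.Omega ψ k) with hT
  have hΩ := hψ.2 k
  have hTT : T * T * c.Omega ψ k = 1 := invSqrt_mul_self_mul hΩ
  have hTH : Tᴴ = T := invSqrt_conjTranspose _
  have hsum : (c.Omega ψ k + (c.Htilde k)ᴴ * Q k * c.Htilde k).PosDef :=
    hΩ.add_posSemidef ((hQ k).conjTranspose_mul_mul_same _)
  have hdet : T.det * T.det * (c.Omega ψ k).det = 1 := by
    rw [← Matrix.det_mul, ← Matrix.det_mul, hTT, Matrix.det_one]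
  have hTΩT : T * c.Omega ψ k * T = 1 := by
    rw [Matrix.mul_assoc] at hTT
    rw [mul_eq_one_comm.mp hTT]
  have h1 : 1 + (c.whitened ψ k)ᴴ * Q k * (c.whitened ψ k)ᴴᴴ =
      T * (c.Omega ψ k + (c.Htilde k)ᴴ * Q k * c.Htilde k) * T := by
    rw [Matrix.mul_add, Matrix.add_mul, hTΩT, Matrix.conjTranspose_conjTranspose, whitened,
      Matrix.conjTranspose_mul, ← hT, hTH]
    simp only [Matrix.mul_assoc]
  have h2 : (1 + (c.whitened ψ k)ᴴ * Q k * (c.whitened ψ k)ᴴᴴ).det =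
      (c.Omega ψ k + (c.Htilde k)ᴴ * Q k * c.Htilde k).det / (c.Omega ψ k).det := by
    rw [h1, Matrix.det_mul, Matrix.det_mul, eq_div_iff hΩ.isUnit_det.ne_zero]
    linear_combination (c.Omega ψ k + (c.Htilde k)ᴴ * Q k * c.Htilde k).det * hdet
  rw [h2, ← hΩ.ofReal_det_re, ← hsum.ofReal_det_re, ← Complex.ofReal_div, Complex.ofReal_re,
    Complex.ofReal_re, Complex.ofReal_re]

/-- The covariances `S` whose priced usage `∑ₖ tr (Ω_k S_k)` is at most `P`: a single sum power
constraint in place of all the constraints of the relaxed problem. -/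
def pricedFeasible (c : CRNetwork K M N n nb nt) (ψ : Fin N ⊕ Fin M → ℝ) (P : ℝ) :
    Set ((k : Fin K) → Matrix (Fin (nb k)) (Fin (nb k)) ℂ) :=
  {S | S ∈ psdTuples nb ∧ ψ ⬝ᵥ c.usage S ≤ P}

theorem relaxedFeasible_subset (hψ : ψ ∈ c.dualMultipliers P) :
    c.relaxedFeasible ⊆ c.pricedFeasible ψ P := by
  intro S hS
  rw [mem_relaxedFeasible_iff] at hS
  refine ⟨hS.1, le_trans ?_ hψ.2⟩
  rw [dotProduct_comm c.limits]
  exact Finset.sum_le_sum fun i _ => mul_le_mul_of_nonneg_left (hS.2 i) (hψ.1.1 i)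

/-- The substitution `S_k = Ω_k^{-1/2} T_k Ω_k^{-1/2}`. -/
def unwhiten (c : CRNetwork K M N n nb nt) (ψ : Fin N ⊕ Fin M → ℝ)
    (T : (k : Fin K) → Matrix (Fin (nb k)) (Fin (nb k)) ℂ) (k : Fin K) :
    Matrix (Fin (nb k)) (Fin (nb k)) ℂ :=
  invSqrt (c.Omega ψ k) * T k * invSqrt (c.Omega ψ k)

theorem sumRate_unwhiten (T : (k : Fin K) → Matrix (Fin (nb k)) (Fin (nb k)) ℂ) :
    c.sumRate (c.unwhiten ψ T) = logRate (c.whitened ψ) T := by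
  unfold sumRate logRate
  refine Finset.sum_congr rfl fun k _ => ?_
  simp only [unwhiten, whitened, Matrix.conjTranspose_mul, invSqrt_conjTranspose,
    Matrix.mul_assoc]

theorem unwhiten_mem (hψ : ψ ∈ c.dualDomain)
    {T : (k : Fin K) → Matrix (Fin (nb k)) (Fin (nb k)) ℂ} (hT : T ∈ dualCovariances nb P) :
    c.unwhiten ψ T ∈ c.pricedFeasible ψ P := by
  refine ⟨fun k => ?_, ?_⟩
  · have := (hT.1 k).mul_mul_conjTranspose_same (invSqrt (c.Omega ψ k))
    rwa [invSqrt_conjTranspose] at this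
  · rw [← sum_trace_Omega_mul]
    refine le_trans (le_of_eq (Finset.sum_congr rfl fun k _ => ?_)) hT.2
    have h := invSqrt_mul_self_mul (hψ.2 k)
    rw [Matrix.mul_assoc] at h
    have h1 : (c.Omega ψ k * c.unwhiten ψ T k).trace =
        (invSqrt (c.Omega ψ k) * c.Omega ψ k * invSqrt (c.Omega ψ k) * T k).trace := by
      simp only [unwhiten]
      rw [← Matrix.mul_assoc, Matrix.trace_mul_comm]
      simp only [Matrix.mul_assoc]
    rw [h1, mul_eq_one_comm.mp h, Matrix.one_mul]

theorem exists_unwhiten_eq (hψ : ψ ∈ c.dualDomain)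
    {S : (k : Fin K) → Matrix (Fin (nb k)) (Fin (nb k)) ℂ} (hS : S ∈ c.pricedFeasible ψ P) :
    ∃ T ∈ dualCovariances nb P, c.unwhiten ψ T = S := by
  have h1 : ∀ k, invSqrt (c.Omega ψ k) * (invSqrt (c.Omega ψ k) * c.Omega ψ k) = 1 := fun k => by
    rw [← Matrix.mul_assoc]
    exact invSqrt_mul_self_mul (hψ.2 k)
  have h2 : ∀ k, c.Omega ψ k * invSqrt (c.Omega ψ k) * invSqrt (c.Omega ψ k) = 1 := fun k => by
    rw [Matrix.mul_assoc]
    exact mul_eq_one_comm.mp (invSqrt_mul_self_mul (hψ.2 k))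
  let T : (k : Fin K) → Matrix (Fin (nb k)) (Fin (nb k)) ℂ := fun k =>
    (invSqrt (c.Omega ψ k) * c.Omega ψ k) * S k * (c.Omega ψ k * invSqrt (c.Omega ψ k))
  refine ⟨T, ⟨fun k => ?_, ?_⟩, ?_⟩
  · have := (hS.1 k).mul_mul_conjTranspose_same (invSqrt (c.Omega ψ k) * c.Omega ψ k)
    rwa [Matrix.conjTranspose_mul, invSqrt_conjTranspose, (hψ.2 k).1.eq] at this
  · refine le_trans (le_of_eq ?_) hS.2
    rw [← sum_trace_Omega_mul]
    refine Finset.sum_congr rfl fun k _ => ?_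
    simp only [T]
    rw [Matrix.trace_mul_cycle, ← Matrix.mul_assoc, h2 k, Matrix.one_mul]
  · funext k
    calc c.unwhiten ψ T k = (invSqrt (c.Omega ψ k) * (invSqrt (c.Omega ψ k) * c.Omega ψ k)) * S k *
          (c.Omega ψ k * invSqrt (c.Omega ψ k) * invSqrt (c.Omega ψ k)) := by
          simp only [unwhiten, T, Matrix.mul_assoc]
      _ = S k := by rw [h1 k, h2 k, Matrix.one_mul, Matrix.mul_one]

theorem whitened_ne_zero (hψ : ψ ∈ c.dualDomain) {k : Fin K} (h : c.Htilde k ≠ 0) :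
    c.whitened ψ k ≠ 0 := by
  intro h0
  refine h ?_
  have h1 := invSqrt_mul_self_mul (hψ.2 k)
  calc c.Htilde k = c.whitened ψ k * (invSqrt (c.Omega ψ k) * c.Omega ψ k) := by
        rw [whitened, Matrix.mul_assoc, ← Matrix.mul_assoc (invSqrt _), h1, Matrix.mul_one]
    _ = 0 := by rw [h0, Matrix.zero_mul]

/-- Uplink covariances can be matched by downlink covariances under the priced constraint. -/
theorem exists_pricedFeasible (hψ : ψ ∈ c.dualDomain)
    {Q : (k : Fin K) → Matrix (Fin (n k)) (Fin (n k)) ℂ} (hQ : Q ∈ dualCovariances n P) :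
    ∃ S ∈ c.pricedFeasible ψ P, c.sumRate S = c.dualObjective ψ Q := by
  obtain ⟨T, hT, h⟩ := exists_dual_covariance (c.whitened ψ) hQ
  exact ⟨_, unwhiten_mem hψ hT, by rw [sumRate_unwhiten, h, dualObjective_eq_logRate hψ hQ.1]⟩

/-- Downlink covariances under the priced constraint can be matched by uplink covariances. -/
theorem exists_dualCovariances (hψ : ψ ∈ c.dualDomain)
    {S : (k : Fin K) → Matrix (Fin (nb k)) (Fin (nb k)) ℂ} (hS : S ∈ c.pricedFeasible ψ P) :
    ∃ Q ∈ dualCovariances n P, c.dualObjective ψ Q = c.sumRate S := by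
  obtain ⟨T, hT, rfl⟩ := exists_unwhiten_eq hψ hS
  obtain ⟨Q, hQ, h⟩ := exists_dual_covariance' (c.whitened ψ) hT
  exact ⟨Q, hQ, by rw [dualObjective_eq_logRate hψ hQ.1, h, sumRate_unwhiten]⟩

end CRNetwork

/-! ### Lagrange multipliers -/

/-- Strong duality for a concave program with linear constraints that satisfies Slater's
condition: the graph of the achievable pairs (objective, resources) is separated from the pair
(optimal value, available resources) by a hyperplane, which Slater's condition forbids to be
vertical. -/
theorem exists_lagrange_multipliers {E ι : Type*} [AddCommGroup E] [Module ℝ E] [Fintype ι]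
    {s : Set E} {R : E → ℝ} (hR : ConcaveOn ℝ s R) {g : E → ι → ℝ}
    (hg : ∀ (x y : ℝ) (S T : E), g (x • S + y • T) = x • g S + y • g T) {p : ι → ℝ} {S₀ : E}
    (hS₀ : S₀ ∈ s) (hslater : ∀ i, g S₀ i < p i) {v : ℝ}
    (hv : ∀ S ∈ s, (∀ i, g S i ≤ p i) → R S ≤ v) :
    ∃ μ : ι → ℝ, (∀ i, 0 ≤ μ i) ∧ ∀ S ∈ s, R S + μ ⬝ᵥ p - μ ⬝ᵥ g S ≤ v := by
  classical
  let C : Set (ℝ × (ι → ℝ)) := {z | ∃ S ∈ s, z.1 < R S ∧ ∀ i, g S i < z.2 i}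
  have hCopen : IsOpen C := by
    have h : C = ⋃ S ∈ s, {z : ℝ × (ι → ℝ) | z.1 < R S} ∩ ⋂ i, {z | g S i < z.2 i} := by
      ext z
      simp only [C, Set.mem_ofPred_eq, Set.mem_iUnion, Set.mem_inter_iff, Set.mem_iInter,
        exists_prop]
    rw [h]
    refine isOpen_biUnion fun S _ => (isOpen_lt continuous_fst continuous_const).inter
      (isOpen_iInter_of_finite fun i => isOpen_lt continuous_const ?_)
    exact (continuous_apply i).comp continuous_snd
  have hCconv : Convex ℝ C := by
    rw [convex_iff_forall_pos]
    rintro z ⟨S, hS, hS1, hS2⟩ w ⟨T, hT, hT1, hT2⟩ x y hx hy hxy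
    refine ⟨x • S + y • T, hR.1 hS hT hx.le hy.le hxy, ?_, fun i => ?_⟩
    · refine lt_of_lt_of_le ?_ (hR.2 hS hT hx.le hy.le hxy)
      exact add_lt_add (mul_lt_mul_of_pos_left hS1 hx) (mul_lt_mul_of_pos_left hT1 hy)
    · rw [hg]
      exact add_lt_add (mul_lt_mul_of_pos_left (hS2 i) hx) (mul_lt_mul_of_pos_left (hT2 i) hy)
  have hnot : (v, p) ∉ C := fun ⟨S, hS, h1, h2⟩ => (hv S hS fun i => (h2 i).le).not_gt h1
  obtain ⟨f, hf⟩ := geometric_hahn_banach_open_point hCconv hCopen hnot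
  set α := f (1, 0) with hα
  let β : ι → ℝ := fun i => f (0, Pi.single i 1)
  have hform : ∀ r y, f (r, y) = α * r + β ⬝ᵥ y := by
    intro r y
    have h1 : (r, y) = r • ((1 : ℝ), (0 : ι → ℝ)) +
        ∑ i, y i • ((0 : ℝ), (Pi.single i 1 : ι → ℝ)) := by
      refine Prod.ext ?_ ?_
      · simp [Prod.fst_sum]
      · funext j
        simp [Prod.snd_sum, Finset.sum_apply, Pi.single_apply]
    rw [h1, map_add, map_sum, map_smul]
    simp only [map_smul, smul_eq_mul, dotProduct, β]
    rw [mul_comm]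
    congr 1
    exact Finset.sum_congr rfl fun i _ => mul_comm _ _
  have hsep : ∀ S ∈ s, ∀ r y, r < R S → (∀ i, g S i < y i) →
      α * r + β ⬝ᵥ y < α * v + β ⬝ᵥ p := by
    intro S hS r y hr hy
    rw [← hform, ← hform]
    exact hf _ ⟨S, hS, hr, hy⟩
  have hvR : R S₀ ≤ v := hv S₀ hS₀ fun i => (hslater i).le
  have hαpos : 0 < α := by
    have h := hsep S₀ hS₀ (R S₀ - 1) p (by linarith) hslater
    nlinarith
  have hβ : ∀ i, β i ≤ 0 := by
    intro i
    by_contra! hpos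
    set t := α * (v - (R S₀ - 1)) / β i with ht
    have ht0 : 0 ≤ t := div_nonneg (mul_nonneg hαpos.le (by linarith)) hpos.le
    have h := hsep S₀ hS₀ (R S₀ - 1) (p + t • Pi.single i 1) (by linarith) fun j => by
      refine (hslater j).trans_le ?_
      rw [Pi.add_apply, Pi.smul_apply, smul_eq_mul]
      have : (0 : ℝ) ≤ (Pi.single i 1 : ι → ℝ) j := by
        by_cases h : j = i
        · subst h; simp
        · simp [h]
      nlinarith
    rw [dotProduct_add, dotProduct_smul, dotProduct_single, smul_eq_mul, mul_one, ht,
      div_mul_cancel₀ _ hpos.ne'] at h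
    linarith
  refine ⟨fun i => -β i / α, fun i => div_nonneg (neg_nonneg.mpr (hβ i)) hαpos.le,
    fun S hS => ?_⟩
  have hlim : α * R S + β ⬝ᵥ g S ≤ α * v + β ⬝ᵥ p := by
    refine le_of_forall_pos_lt_add fun δ hδ => ?_
    have hβs : ∑ i, β i ≤ 0 := Finset.sum_nonpos fun i _ => hβ i
    have hden : 0 < α - ∑ i, β i := by linarith
    set ε := δ / (α - ∑ i, β i) with hε
    have hεpos : 0 < ε := div_pos hδ hden
    have h := hsep S hS (R S - ε) (fun i => g S i + ε) (by linarith) fun i => by linarith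
    have h1 : (β ⬝ᵥ fun i => g S i + ε) = β ⬝ᵥ g S + (∑ i, β i) * ε := by
      simp only [dotProduct, mul_add, Finset.sum_add_distrib, Finset.sum_mul]
    have h2 : ε * (α - ∑ i, β i) = δ := div_mul_cancel₀ _ hden.ne'
    rw [h1] at h
    nlinarith
  have hdot : ∀ y : ι → ℝ, (fun i => -β i / α) ⬝ᵥ y = -(β ⬝ᵥ y) / α := by
    intro y
    simp only [dotProduct, ← Finset.sum_neg_distrib, Finset.sum_div]
    exact Finset.sum_congr rfl fun i _ => by ring
  rw [hdot, hdot]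
  have h3 : R S + -(β ⬝ᵥ p) / α - -(β ⬝ᵥ g S) / α =
      (α * R S + β ⬝ᵥ g S - β ⬝ᵥ p) / α := by
    field_simp
    ring
  rw [h3, div_le_iff₀ hαpos]
  linarith

namespace CRNetwork

variable {K M N : ℕ} {n nb : Fin K → ℕ} {nt : Fin M → ℕ} {c : CRNetwork K M N n nb nt}
  {ψ : Fin N ⊕ Fin M → ℝ} {P : ℝ}

theorem limits_pos (hpower : ∀ i, 0 < c.power i) (hinterf : ∀ m, 0 < c.interf m)
    (i : Fin N ⊕ Fin M) : 0 < c.limits i := by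
  rcases i with i | m
  · exact hpower i
  · exact hinterf m

theorem exists_mem_dualDomain (hV : c.IsZeroForcing) (hp : ∀ i, 0 < c.limits i) (hP : 0 < P) :
    ∃ ψ ∈ c.dualDomain, c.limits ⬝ᵥ ψ ≤ P ∧ (0 < N → c.limits ⬝ᵥ ψ = P) := by
  rcases isEmpty_or_nonempty (Fin N ⊕ Fin M) with h | h
  · refine ⟨0, mem_dualDomain_of_pos hV fun i => h.elim i, by simpa using hP.le, fun hN => ?_⟩
    exact h.elim (Sum.inl ⟨0, hN⟩)
  · have hcard : (0 : ℝ) < Fintype.card (Fin N ⊕ Fin M) := by exact_mod_cast Fintype.card_pos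
    have hsum : c.limits ⬝ᵥ (fun i => P / (Fintype.card (Fin N ⊕ Fin M) * c.limits i)) = P := by
      have : ∀ i, c.limits i * (P / (Fintype.card (Fin N ⊕ Fin M) * c.limits i)) =
          P / Fintype.card (Fin N ⊕ Fin M) := fun i => by
        have := (hp i).ne'
        field_simp
      simp only [dotProduct, this, Finset.sum_const, Finset.card_univ, nsmul_eq_mul]
      field_simp
    exact ⟨_, mem_dualDomain_of_pos hV fun i => div_pos hP (mul_pos hcard (hp i)), hsum.le,
      fun _ => hsum⟩

theorem exists_relaxed_max (hV : c.IsZeroForcing) (hp : ∀ i, 0 < c.limits i) :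
    ∃ S, c.IsRelaxedOptimal S := by
  obtain ⟨ψ, hψ, hψP, -⟩ := exists_mem_dualDomain hV hp one_pos
  have hcont : Continuous (c.unwhiten ψ) := continuous_pi fun k =>
    (continuous_const.matrix_mul (continuous_apply k)).matrix_mul continuous_const
  have hclosed : IsClosed c.relaxedFeasible := by
    have h : c.relaxedFeasible = psdTuples nb ∩ ⋂ i, {S | c.usage S i ≤ c.limits i} := by
      ext S
      simp [mem_relaxedFeasible_iff]
    rw [h]
    refine (isClosed_psdTuples nb).inter (isClosed_iInter fun i =>
      isClosed_le ?_ continuous_const)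
    rcases i with i | m
    · change Continuous fun S : (k : Fin K) → Matrix (Fin (nb k)) (Fin (nb k)) ℂ =>
        ∑ k, ((c.V k * S k * (c.V k)ᴴ) i i).re
      refine continuous_finsetSum _ fun k _ => Complex.continuous_re.comp ?_
      exact ((continuous_const.matrix_mul (continuous_apply k)).matrix_mul
        continuous_const).matrix_elem i i
    · change Continuous fun S : (k : Fin K) → Matrix (Fin (nb k)) (Fin (nb k)) ℂ =>
        ∑ k, (c.Gtilde m k * S k * (c.Gtilde m k)ᴴ).trace.re
      refine continuous_finsetSum _ fun k _ => Complex.continuous_re.comp ?_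
      exact ((continuous_const.matrix_mul (continuous_apply k)).matrix_mul
        continuous_const).matrix_trace
  have hsub : c.relaxedFeasible ⊆ c.unwhiten ψ '' dualCovariances nb 1 := fun S hS =>
    exists_unwhiten_eq hψ (relaxedFeasible_subset ⟨hψ, hψP⟩ hS)
  have hcompact : IsCompact c.relaxedFeasible :=
    ((isCompact_dualCovariances nb 1).image hcont).of_isClosed_subset hclosed hsub
  have hne : c.relaxedFeasible.Nonempty := ⟨0, mem_relaxedFeasible_iff.mpr
    ⟨fun _ => Matrix.PosSemidef.zero, fun i => by rw [usage_zero]; exact (hp i).le⟩⟩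
  obtain ⟨S, hS, hmax⟩ := hcompact.exists_isMaxOn hne
    ((continuousOn_logRate (A := c.Htilde)).mono fun S hS => hS.1)
  exact ⟨S, hS, hmax⟩

theorem exists_multipliers (hp : ∀ i, 0 < c.limits i) {v : ℝ}
    (hv : ∀ S ∈ c.relaxedFeasible, c.sumRate S ≤ v) :
    ∃ μ : Fin N ⊕ Fin M → ℝ, (∀ i, 0 ≤ μ i) ∧
      ∀ S ∈ psdTuples nb, c.sumRate S + μ ⬝ᵥ c.limits - μ ⬝ᵥ c.usage S ≤ v := by
  refine exists_lagrange_multipliers (s := psdTuples nb) (R := c.sumRate) (g := c.usage)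
    ⟨convex_psdTuples nb, fun S hS T hT x y hx hy hxy => ?_⟩ usage_combo (S₀ := 0)
    (fun _ => Matrix.PosSemidef.zero) (fun i => by rw [usage_zero]; exact hp i)
    (fun S hS h => hv S (mem_relaxedFeasible_iff.mpr ⟨hS, h⟩))
  exact (logRate_concave hS hT hx hy hxy).1

/-- The dual value is approached: a small positive multiple of an interior multiplier makes the
Lagrange multipliers admissible, whether or not they lie in the domain themselves. -/
theorem exists_dual_le (hV : c.IsZeroForcing) (hp : ∀ i, 0 < c.limits i) (hP : 0 < P) {v : ℝ}
    (hv : ∀ S ∈ c.relaxedFeasible, c.sumRate S ≤ v) {ε : ℝ} (hε : 0 < ε) :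
    ∃ ψ ∈ c.dualDomain, c.limits ⬝ᵥ ψ ≤ P ∧ (0 < N → c.limits ⬝ᵥ ψ = P) ∧
      ∀ Q ∈ dualCovariances n P, c.dualObjective ψ Q ≤ v + ε := by
  obtain ⟨μ, hμ, hlag⟩ := exists_multipliers hp hv
  obtain ⟨ψ₀, hψ₀, hle, heq⟩ := exists_mem_dualDomain hV hp hP
  set s := c.limits ⬝ᵥ μ with hs
  have hs0 : 0 ≤ s := Finset.sum_nonneg fun i _ => mul_nonneg (hp i).le (hμ i)
  set δ := ε / P with hδ
  have hδ0 : 0 < δ := div_pos hε hP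
  have hδP : δ * P = ε := div_mul_cancel₀ _ hP.ne'
  have hden : 0 < s + ε := by linarith
  -- the normalisation that makes `a (μ + δ ψ₀)` spend `P`
  set a := P / (s + ε) with ha
  have ha0 : 0 < a := div_pos hP hden
  have hasε : a * (s + ε) = P := div_mul_cancel₀ _ hden.ne'
  have hdom : a • μ + (a * δ) • ψ₀ ∈ c.dualDomain :=
    add_mem_dualDomain hμ hψ₀ ha0.le (mul_pos ha0 hδ0)
  have hdot : c.limits ⬝ᵥ (a • μ + (a * δ) • ψ₀) = a * (s + δ * (c.limits ⬝ᵥ ψ₀)) := by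
    rw [dotProduct_add, dotProduct_smul, dotProduct_smul, smul_eq_mul, smul_eq_mul]
    ring
  refine ⟨a • μ + (a * δ) • ψ₀, hdom, ?_, fun hN => ?_, fun Q hQ => ?_⟩
  · rw [hdot, ← hasε, ← hδP]
    exact mul_le_mul_of_nonneg_left (by gcongr) ha0.le
  · rw [hdot, heq hN, hδP, hasε]
  · obtain ⟨S, hS, hSQ⟩ := exists_pricedFeasible hdom hQ
    have h1 := hlag S hS.1
    have h2 : 0 ≤ ψ₀ ⬝ᵥ c.usage S := by
      rw [← sum_trace_Omega_mul]
      exact Finset.sum_nonneg fun k _ => (hψ₀.2 k).posSemidef.trace_mul_re_nonneg (hS.1 k)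
    have h3 : a * (μ ⬝ᵥ c.usage S) ≤ a * (s + ε) := by
      have h4 := hS.2
      rw [add_dotProduct, smul_dotProduct, smul_dotProduct, smul_eq_mul, smul_eq_mul] at h4
      have h5 : 0 ≤ a * δ * (ψ₀ ⬝ᵥ c.usage S) := mul_nonneg (mul_pos ha0 hδ0).le h2
      linarith
    have h6 := le_of_mul_le_mul_left h3 ha0
    rw [← hSQ]
    rw [dotProduct_comm μ c.limits] at h1
    linarith

theorem exists_dual_max (hψ : ψ ∈ c.dualDomain) (hP : 0 ≤ P) :
    ∃ Q ∈ dualCovariances n P, ∀ Q' ∈ dualCovariances n P,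
      c.dualObjective ψ Q' ≤ c.dualObjective ψ Q := by
  obtain ⟨Q, hQ, hmax⟩ := exists_max_logRate (A := fun k => (c.whitened ψ k)ᴴ) hP
  refine ⟨Q, hQ, fun Q' hQ' => ?_⟩
  rw [dualObjective_eq_logRate hψ hQ'.1, dualObjective_eq_logRate hψ hQ.1]
  exact hmax Q' hQ'

theorem dual_full_power (hψ : ψ ∈ c.dualDomain) {k₀ : Fin K} (hk : c.Htilde k₀ ≠ 0)
    {Q : (k : Fin K) → Matrix (Fin (n k)) (Fin (n k)) ℂ} (hQ : Q ∈ dualCovariances n P) :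
    ∃ Q' ∈ dualCovariancesEq n P, c.dualObjective ψ Q ≤ c.dualObjective ψ Q' ∧
      (∑ k, (Q k).trace.re < P → c.dualObjective ψ Q < c.dualObjective ψ Q') := by
  have hA : (fun k => (c.whitened ψ k)ᴴ) k₀ ≠ 0 := fun h =>
    whitened_ne_zero hψ hk (Matrix.conjTranspose_eq_zero.mp h)
  obtain ⟨Q', hQ', h1, h2⟩ := exists_full_power (A := fun k => (c.whitened ψ k)ᴴ) hA hQ
  refine ⟨Q', hQ', ?_⟩
  rw [dualObjective_eq_logRate hψ hQ.1, dualObjective_eq_logRate hψ hQ'.1]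
  exact ⟨h1, h2⟩

theorem dual_max_unique (hψ : ψ ∈ c.dualDomain) {k₀ : Fin K} (hk : c.Htilde k₀ ≠ 0)
    {Q Q' : (k : Fin K) → Matrix (Fin (n k)) (Fin (n k)) ℂ} (hQ : Q ∈ dualCovariances n P)
    (hmax : ∀ R ∈ dualCovariances n P, c.dualObjective ψ R ≤ c.dualObjective ψ Q)
    (hQ' : Q' ∈ dualCovariances n P) (hle : c.dualObjective ψ Q ≤ c.dualObjective ψ Q') :
    Q = Q' := by
  have hA : (fun k => (c.whitened ψ k)ᴴ) k₀ ≠ 0 := fun h =>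
    whitened_ne_zero hψ hk (Matrix.conjTranspose_eq_zero.mp h)
  refine max_unique (A := fun k => (c.whitened ψ k)ᴴ) hA hQ (fun R hR => ?_) hQ' ?_
  · rw [← dualObjective_eq_logRate hψ hR.1, ← dualObjective_eq_logRate hψ hQ.1]
    exact hmax R hR
  · rwa [← dualObjective_eq_logRate hψ hQ.1, ← dualObjective_eq_logRate hψ hQ'.1]

theorem dualObjective_smul {t : ℝ} (ht : 0 < t)
    (Q : (k : Fin K) → Matrix (Fin (n k)) (Fin (n k)) ℂ) :
    c.dualObjective (t • ψ) Q = c.dualObjective ψ (t⁻¹ • Q) := by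
  unfold dualObjective
  refine Finset.sum_congr rfl fun k _ => ?_
  have h1 : c.Omega (t • ψ) k + (c.Htilde k)ᴴ * Q k * c.Htilde k =
      t • (c.Omega ψ k + (c.Htilde k)ᴴ * (t⁻¹ • Q) k * c.Htilde k) := by
    rw [Omega_smul, smul_add, Pi.smul_apply, Matrix.mul_smul, Matrix.smul_mul, smul_smul,
      mul_inv_cancel₀ ht.ne', one_smul]
  have h2 : ∀ X : Matrix (Fin (nb k)) (Fin (nb k)) ℂ, (t • X).det.re = t ^ nb k * X.det.re := by
    intro X
    have : (t • X) = (t : ℂ) • X := by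
      ext i j
      simp
    rw [this, Matrix.det_smul, Fintype.card_fin, ← Complex.ofReal_pow, Complex.re_ofReal_mul]
  rw [h1, Omega_smul, h2, h2, mul_div_mul_left _ _ (pow_pos ht _).ne']

theorem limits_dotProduct_pos (hp : ∀ i, 0 < c.limits i) (hψ : ψ ∈ c.dualDomain) {k₀ : Fin K}
    (hk : c.Htilde k₀ ≠ 0) : 0 < c.limits ⬝ᵥ ψ := by
  have hne : ψ ≠ 0 := by
    rintro rfl
    have h := hψ.2 k₀
    rw [Omega_zero] at h
    have : IsEmpty (Fin (nb k₀)) := by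
      by_contra hcon
      rw [not_isEmpty_iff] at hcon
      simpa using h.isUnit_det
    exact hk (Matrix.ext fun i j => this.elim j)
  obtain ⟨i, hi⟩ := Function.ne_iff.mp hne
  exact Finset.sum_pos' (fun i _ => mul_nonneg (hp i).le (hψ.1 i))
    ⟨i, Finset.mem_univ _, mul_pos (hp i) (lt_of_le_of_ne (hψ.1 i) (Ne.symm hi))⟩

theorem smul_mem_dualCovariances {Q : (k : Fin K) → Matrix (Fin (n k)) (Fin (n k)) ℂ}
    (hQ : Q ∈ dualCovariances n P) {t : ℝ} (ht0 : 0 ≤ t) :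
    t • Q ∈ dualCovariances n (t * P) :=
  ⟨smul_mem_psdTuples hQ.1 ht0, by
    rw [sum_trace_smul]; exact mul_le_mul_of_nonneg_left hQ.2 ht0⟩

/-- A solution of the minimax program spends all the power: otherwise `Q` could be improved, or,
`f (t ψ, Q) = f (ψ, Q / t)`, scaling up `ψ` would decrease the inner maximum. -/
theorem minimaxSolution_iff_eq (hp : ∀ i, 0 < c.limits i) (hP : 0 < P) {k₀ : Fin K}
    (hk : c.Htilde k₀ ≠ 0) {Q : (k : Fin K) → Matrix (Fin (n k)) (Fin (n k)) ℂ} :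
    IsMinimaxSolution c.dualObjective (c.dualMultipliers P) (dualCovariances n P) ψ Q ↔
      IsMinimaxSolution c.dualObjective (c.dualMultipliersEq P) (dualCovariancesEq n P) ψ Q := by
  constructor
  · rintro ⟨hψ, hQ, hmax, hmin⟩
    have htr : ∑ k, (Q k).trace.re = P := by
      by_contra hne
      obtain ⟨Q', hQ', -, h⟩ := dual_full_power hψ.1 hk hQ
      exact (h (lt_of_le_of_ne hQ.2 hne)).not_ge (hmax _ (dualCovariancesEq_subset n P hQ'))
    have hψP : c.limits ⬝ᵥ ψ = P := by
      by_contra hne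
      have hlt : c.limits ⬝ᵥ ψ < P := lt_of_le_of_ne hψ.2 hne
      have hs := limits_dotProduct_pos hp hψ.1 hk
      set t := P / (c.limits ⬝ᵥ ψ) with ht
      have ht1 : 1 < t := (one_lt_div hs).mpr hlt
      have ht0 : 0 < t := one_pos.trans ht1
      have hmem : t • ψ ∈ c.dualMultipliers P :=
        ⟨smul_mem_dualDomain hψ.1 ht0, by
          rw [dotProduct_smul, smul_eq_mul, ht, div_mul_cancel₀ _ hs.ne']⟩
      obtain ⟨Q', hQ', h1⟩ := hmin _ hmem
      rw [dualObjective_smul ht0] at h1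
      have h2 : t⁻¹ • Q' ∈ dualCovariances n (t⁻¹ * P) :=
        smul_mem_dualCovariances hQ' (inv_pos.mpr ht0).le
      have h3 : t⁻¹ * P < P := by
        have : t⁻¹ < 1 := inv_lt_one_of_one_lt₀ ht1
        nlinarith
      obtain ⟨R, hR, -, h4⟩ := dual_full_power (P := P) hψ.1 hk ⟨h2.1, h2.2.trans h3.le⟩
      have h5 := hmax R (dualCovariancesEq_subset n P hR)
      linarith [h4 (h2.2.trans_lt h3)]
    refine ⟨⟨hψ.1, hψP⟩, ⟨hQ.1, htr⟩, fun Q' hQ' => hmax Q' (dualCovariancesEq_subset n P hQ'),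
      fun ψ' hψ' => ?_⟩
    obtain ⟨Q', hQ', h1⟩ := hmin ψ' ⟨hψ'.1, hψ'.2.le⟩
    obtain ⟨R, hR, h2, -⟩ := dual_full_power hψ'.1 hk hQ'
    exact ⟨R, hR, h1.trans h2⟩
  · rintro ⟨hψ, hQ, hmax, hmin⟩
    refine ⟨⟨hψ.1, hψ.2.le⟩, dualCovariancesEq_subset n P hQ, fun Q' hQ' => ?_,
      fun ψ' hψ' => ?_⟩
    · obtain ⟨R, hR, h, -⟩ := dual_full_power hψ.1 hk hQ'
      exact h.trans (hmax R hR)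
    · have hs := limits_dotProduct_pos hp hψ'.1 hk
      set t := P / (c.limits ⬝ᵥ ψ') with ht
      have ht1 : 1 ≤ t := (one_le_div hs).mpr hψ'.2
      have ht0 : 0 < t := one_pos.trans_le ht1
      obtain ⟨Q', hQ', h1⟩ := hmin (t • ψ') ⟨smul_mem_dualDomain hψ'.1 ht0, by
          rw [dotProduct_smul, smul_eq_mul, ht, div_mul_cancel₀ _ hs.ne']⟩
      rw [dualObjective_smul ht0] at h1
      have h2 : t⁻¹ • Q' ∈ dualCovariances n (t⁻¹ * P) :=
        smul_mem_dualCovariances (dualCovariancesEq_subset n P hQ') (inv_pos.mpr ht0).le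
      have h3 : t⁻¹ * P ≤ P := by
        have : t⁻¹ ≤ 1 := inv_le_one_of_one_le₀ ht1
        nlinarith
      exact ⟨_, ⟨h2.1, h2.2.trans h3⟩, h1⟩

end CRNetwork

/-! ### Saddle points and recovery of the downlink covariances -/

namespace CRNetwork

variable {K M N : ℕ} {n nb : Fin K → ℕ} {nt : Fin M → ℕ} {c : CRNetwork K M N n nb nt}
  {ψ : Fin N ⊕ Fin M → ℝ} {P : ℝ}

/-- A direction in the kernel of `Ω_k` is free of charge, so it cannot carry any rate when the
Lagrangian is bounded. -/
theorem ker_Omega_le_ker_Htilde {μ : Fin N ⊕ Fin M → ℝ} {v : ℝ}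
    (hlag : ∀ S ∈ psdTuples nb, c.sumRate S - μ ⬝ᵥ c.usage S ≤ v) (k : Fin K) :
    LinearMap.ker (c.Omega μ k).mulVecLin ≤ LinearMap.ker (c.Htilde k).mulVecLin := by
  intro x hx
  rw [LinearMap.mem_ker, Matrix.mulVecLin_apply] at hx ⊢
  by_contra hne
  set y := c.Htilde k *ᵥ x with hy
  have hq : 0 < star y ⬝ᵥ y := lt_of_le_of_ne (dotProduct_star_self_nonneg y)
    fun h => hne (dotProduct_star_self_eq_zero.mp h.symm)
  set q := (star y ⬝ᵥ y).re with hqdef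
  have hq0 : 0 < q := (Complex.pos_iff.mp hq).1
  -- with this power in the direction `x` the rate `log (1 + t q)` exceeds `v + 1`
  set t := Real.exp (v + 1) / q with ht
  have ht0 : 0 < t := div_pos (Real.exp_pos _) hq0
  let S : (j : Fin K) → Matrix (Fin (nb j)) (Fin (nb j)) ℂ :=
    Pi.single k (t • vecMulVec x (star x))
  have hS : S ∈ psdTuples nb := by
    intro j
    by_cases hj : j = k
    · subst hj
      simp only [S, Pi.single_eq_same]
      exact (Matrix.posSemidef_vecMulVec_self_star x).smul_real ht0.le
    · simp only [S, Pi.single_eq_of_ne hj]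
      exact Matrix.PosSemidef.zero
  have husage : μ ⬝ᵥ c.usage S = 0 := by
    rw [← sum_trace_Omega_mul]
    refine Finset.sum_eq_zero fun j _ => ?_
    by_cases hj : j = k
    · subst hj
      simp only [S, Pi.single_eq_same]
      rw [Matrix.mul_smul, Matrix.mul_vecMulVec, hx]
      simp
    · simp [S, Pi.single_eq_of_ne hj]
  have hrate : c.sumRate S = Real.log (1 + t * q) := by
    have h1 : c.sumRate S = Real.log (1 + c.Htilde k * S k * (c.Htilde k)ᴴ).det.re := by
      refine Finset.sum_eq_single k (fun j _ hj => ?_) (by simp)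
      simp [S, Pi.single_eq_of_ne hj]
    have h2 : c.Htilde k * S k * (c.Htilde k)ᴴ = vecMulVec ((t : ℂ) • y) (star y) := by
      simp only [S, Pi.single_eq_same]
      rw [Matrix.mul_smul, Matrix.smul_mul, Matrix.mul_vecMulVec, Matrix.vecMulVec_mul,
        ← Matrix.star_mulVec, Matrix.smul_vecMulVec]
      ext i j
      simp [hy]
    have h3 : star y ⬝ᵥ y = (q : ℂ) := Complex.ext rfl (Complex.pos_iff.mp hq).2.symm
    rw [h1, h2, Matrix.vecMulVec_eq Unit, Matrix.det_one_add_replicateCol_mul_replicateRow,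
      dotProduct_smul, h3, smul_eq_mul, ← Complex.ofReal_mul, Complex.add_re, Complex.one_re,
      Complex.ofReal_re]
  have h := hlag S hS
  rw [husage, hrate, sub_zero, ht, div_mul_cancel₀ _ hq0.ne'] at h
  have h4 : v + 1 < Real.log (1 + Real.exp (v + 1)) := by
    rw [Real.lt_log_iff_exp_lt (by positivity)]
    linarith
  linarith

theorem dualObjective_eq_zero (hψ : ψ ∈ c.dualDomain) (h : ∀ k, c.Htilde k = 0)
    (Q : (k : Fin K) → Matrix (Fin (n k)) (Fin (n k)) ℂ) : c.dualObjective ψ Q = 0 := by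
  refine Finset.sum_eq_zero fun k _ => ?_
  rw [h k, Matrix.mul_zero, add_zero, div_self (hψ.2 k).det_re_pos.ne', Real.log_one]

theorem continuousOn_dualObjective (hψ : ψ ∈ c.dualDomain) :
    ContinuousOn (c.dualObjective ψ) (psdTuples n) :=
  (continuousOn_logRate (A := fun k => (c.whitened ψ k)ᴴ)).congr fun _ hQ =>
    dualObjective_eq_logRate hψ hQ

theorem concaveOn_dualObjective (hψ : ψ ∈ c.dualDomain) :
    ConcaveOn ℝ (psdTuples n) (c.dualObjective ψ) := by
  refine ⟨convex_psdTuples n, fun Q hQ R hR x y hx hy hxy => ?_⟩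
  rw [dualObjective_eq_logRate hψ hQ, dualObjective_eq_logRate hψ hR,
    dualObjective_eq_logRate hψ (convex_psdTuples n hQ hR hx hy hxy)]
  exact (logRate_concave hQ hR hx hy hxy).1

/-- Weak duality, with a witness: the relaxed optimum is matched at every admissible `ψ`. -/
theorem exists_dual_ge (hψ : ψ ∈ c.dualMultipliers P)
    {S : (k : Fin K) → Matrix (Fin (nb k)) (Fin (nb k)) ℂ} (hS : S ∈ c.relaxedFeasible) :
    ∃ Q ∈ dualCovariances n P, c.dualObjective ψ Q = c.sumRate S :=
  exists_dualCovariances hψ.1 (relaxedFeasible_subset hψ hS)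

/-- At a multiplier whose inner maximum is the minimax value `v`, the inner maximizer `Q` is the
second half of a saddle point. For `ψ'` admissible, let `Q_t` be an inner maximizer at
`(1 - t) ψ + t ψ'`. Convexity in `ψ` gives `f (ψ', Q_t) ≥ v`, and `f (ψ, Q_t) → v` as `t → 0`.
Hence the maximum of `f (ψ, ·)` over the compact set `{f (ψ', ·) ≥ v}` is `v`, and by uniqueness
of the inner maximizer it is attained at `Q`. -/
theorem le_dualObjective_of_minimax {k₀ : Fin K} (hk : c.Htilde k₀ ≠ 0) (hP : 0 < P)
    (hψ : ψ ∈ c.dualMultipliers P) {Q : (k : Fin K) → Matrix (Fin (n k)) (Fin (n k)) ℂ}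
    (hQ : Q ∈ dualCovariances n P)
    (hmax : ∀ R ∈ dualCovariances n P, c.dualObjective ψ R ≤ c.dualObjective ψ Q)
    (hmin : ∀ φ ∈ c.dualMultipliers P, ∃ R ∈ dualCovariances n P,
      c.dualObjective ψ Q ≤ c.dualObjective φ R)
    {ψ' : Fin N ⊕ Fin M → ℝ} (hψ' : ψ' ∈ c.dualMultipliers P) :
    c.dualObjective ψ Q ≤ c.dualObjective ψ' Q := by
  set v := c.dualObjective ψ Q with hv
  obtain ⟨R', hR', hR'max⟩ := exists_dual_max (c := c) hψ'.1 hP.le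
  set G := c.dualObjective ψ' R' with hG
  have hmix : ∀ t : ℝ, 0 < t → t < 1 → ∃ R ∈ dualCovariances n P,
      v ≤ c.dualObjective ψ' R ∧ v ≤ (1 - t) * c.dualObjective ψ R + t * G := by
    intro t ht0 ht1
    have h1t : 0 ≤ 1 - t := by linarith
    obtain ⟨R, hR, h1⟩ := hmin _ (convex_dualMultipliers hψ hψ' h1t ht0.le (by ring))
    have h2 := (convexOn_dualObjective hR.1).2 hψ.1 hψ'.1 h1t ht0.le (by ring)
    simp only [smul_eq_mul] at h2
    have h3 := mul_le_mul_of_nonneg_left (hmax R hR) h1t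
    have h4 := mul_le_mul_of_nonneg_left (hR'max R hR) ht0.le
    refine ⟨R, hR, ?_, by linarith⟩
    have h5 : t * v ≤ t * c.dualObjective ψ' R := by linarith
    exact le_of_mul_le_mul_left h5 ht0
  let C := dualCovariances n P ∩ c.dualObjective ψ' ⁻¹' Set.Ici v
  have hCcompact : IsCompact C :=
    (isCompact_dualCovariances n P).of_isClosed_subset
      (((continuousOn_dualObjective hψ'.1).mono fun _ h => h.1).preimage_isClosed_of_isClosed
        (isCompact_dualCovariances n P).isClosed isClosed_Ici) Set.inter_subset_left
  obtain ⟨R₀, hR₀, hR₀v, -⟩ := hmix (1 / 2) (by norm_num) (by norm_num)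
  obtain ⟨R, hR, hRmax⟩ := hCcompact.exists_isMaxOn ⟨R₀, hR₀, hR₀v⟩
    ((continuousOn_dualObjective hψ.1).mono fun _ h => h.1.1)
  have hRv : v ≤ c.dualObjective ψ R := by
    by_contra! hlt
    set m := c.dualObjective ψ R with hm
    set d := v - m with hd
    have hd0 : 0 < d := sub_pos.mpr hlt
    have hden : 0 < 2 * (|G - m| + d) := by positivity
    -- so small that `(1 - t) m + t G` stays below `v`
    set t := d / (2 * (|G - m| + d)) with ht
    have ht0 : 0 < t := div_pos hd0 hden
    have htd : t * (2 * (|G - m| + d)) = d := div_mul_cancel₀ _ hden.ne'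
    have ht1 : t < 1 := by
      rw [ht, div_lt_one hden]
      linarith [abs_nonneg (G - m)]
    obtain ⟨T, hT, hT1, hT2⟩ := hmix t ht0 ht1
    have h1 : c.dualObjective ψ T ≤ m := hRmax ⟨hT, hT1⟩
    have h2 := mul_le_mul_of_nonneg_left h1 (sub_nonneg.mpr ht1.le)
    have h3 := mul_le_mul_of_nonneg_left (le_abs_self (G - m)) ht0.le
    have h4 := mul_pos ht0 hd0
    linarith
  rw [dual_max_unique hψ.1 hk hQ hmax hR.1 hRv]
  exact hR.2

/-- Bounded Lagrangians force `ker Ω_k ≤ ker H_k V_k`, so for non-degenerate channels the Lagrange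
multipliers lie in the dual domain; rescaled to spend `P` they are half of a saddle point. -/
theorem exists_saddle (hV : c.IsZeroForcing) (hp : ∀ i, 0 < c.limits i) (hP : 0 < P)
    (hreg : ∀ ψ : Fin N ⊕ Fin M → ℝ, (∀ i, 0 ≤ ψ i) →
      (∀ k, LinearMap.ker (c.Omega ψ k).mulVecLin ≤ LinearMap.ker (c.Htilde k).mulVecLin) →
      ∀ k, (c.Omega ψ k).PosDef) :
    ∃ ψ Q, IsMinimaxSaddle c.dualObjective (c.dualMultipliers P) (dualCovariances n P) ψ Q := by
  by_cases hall : ∀ k, c.Htilde k = 0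
  · obtain ⟨ψ, hψ, hψP, -⟩ := exists_mem_dualDomain hV hp hP
    refine ⟨ψ, 0, ⟨hψ, hψP⟩, zero_mem_dualCovariances n hP.le, fun Q _ => ?_, fun φ hφ => ?_⟩
    · rw [dualObjective_eq_zero hψ hall, dualObjective_eq_zero hψ hall]
    · rw [dualObjective_eq_zero hψ hall, dualObjective_eq_zero hφ.1 hall]
  push Not at hall
  obtain ⟨k₀, hk⟩ := hall
  obtain ⟨S, hS, hSmax⟩ := exists_relaxed_max hV hp
  obtain ⟨μ, hμ, hlag⟩ := exists_multipliers hp hSmax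
  have hμdom : μ ∈ c.dualDomain := ⟨hμ, hreg μ hμ <| ker_Omega_le_ker_Htilde
    (v := c.sumRate S - μ ⬝ᵥ c.limits) fun T hT => by linarith [hlag T hT]⟩
  have hs := limits_dotProduct_pos hp hμdom hk
  set s := c.limits ⬝ᵥ μ with hsdef
  have ha0 : 0 < P / s := div_pos hP hs
  have haP : P / s * s = P := div_mul_cancel₀ _ hs.ne'
  have hψ : (P / s) • μ ∈ c.dualMultipliers P :=
    ⟨smul_mem_dualDomain hμdom ha0, by rw [dotProduct_smul, smul_eq_mul, haP]⟩
  obtain ⟨Q, hQ, hmax⟩ := exists_dual_max (c := c) hψ.1 hP.le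
  have hle : c.dualObjective ((P / s) • μ) Q ≤ c.sumRate S := by
    obtain ⟨T, hT, h⟩ := exists_pricedFeasible hψ.1 hQ
    have h1 := hT.2
    rw [smul_dotProduct, smul_eq_mul] at h1
    have h2 : μ ⬝ᵥ c.usage T ≤ s := le_of_mul_le_mul_left (h1.trans_eq haP.symm) ha0
    have h3 := hlag T hT.1
    rw [dotProduct_comm μ c.limits] at h3
    linarith
  refine ⟨_, Q, hψ, hQ, hmax, fun φ hφ =>
    le_dualObjective_of_minimax hk hP hψ hQ hmax (fun χ hχ => ?_) hφ⟩
  obtain ⟨R, hR, h⟩ := exists_dual_ge hχ hS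
  exact ⟨R, hR, h ▸ hle⟩

/-- At a solution of the minimax program the value is the relaxed optimum. -/
theorem minimaxSolution_value (hV : c.IsZeroForcing) (hp : ∀ i, 0 < c.limits i) (hP : 0 < P)
    {Q : (k : Fin K) → Matrix (Fin (n k)) (Fin (n k)) ℂ}
    (h : IsMinimaxSolution c.dualObjective (c.dualMultipliers P) (dualCovariances n P) ψ Q)
    {S : (k : Fin K) → Matrix (Fin (nb k)) (Fin (nb k)) ℂ} (hS : c.IsRelaxedOptimal S) :
    c.dualObjective ψ Q = c.sumRate S := by
  obtain ⟨hψ, hQ, hmax, hmin⟩ := h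
  refine le_antisymm (le_of_forall_pos_le_add fun ε hε => ?_) ?_
  · obtain ⟨φ, hφ, hφP, -, hle⟩ := exists_dual_le hV hp hP hS.2 hε
    obtain ⟨R, hR, h⟩ := hmin φ ⟨hφ, hφP⟩
    exact h.trans (hle R hR)
  · obtain ⟨R, hR, h⟩ := exists_dual_ge hψ hS.1
    exact h ▸ hmax R hR

theorem recovered_eq_unwhiten (Q : (k : Fin K) → Matrix (Fin (n k)) (Fin (n k)) ℂ)
    {r : Fin K → ℕ} (U : (k : Fin K) → Matrix (Fin (n k)) (Fin (r k)) ℂ)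
    (W : (k : Fin K) → Matrix (Fin (nb k)) (Fin (r k)) ℂ) :
    c.recovered ψ Q U W = c.unwhiten ψ (fun k => W k * (U k)ᴴ * Q k * U k * (W k)ᴴ) := by
  funext k
  simp only [recovered, unwhiten, Matrix.mul_assoc]

/-- Recovery of the relaxed optimum: at a solution it also maximizes the rate under the single
priced constraint, where maximizers are unique and the duality map provides one. -/
theorem eq_recovered (hV : c.IsZeroForcing) (hp : ∀ i, 0 < c.limits i) (hP : 0 < P)
    {k₀ : Fin K} (hk : c.Htilde k₀ ≠ 0)
    {Q : (k : Fin K) → Matrix (Fin (n k)) (Fin (n k)) ℂ}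
    (h : IsMinimaxSolution c.dualObjective (c.dualMultipliers P) (dualCovariances n P) ψ Q)
    {r : Fin K → ℕ} {U : (k : Fin K) → Matrix (Fin (n k)) (Fin (r k)) ℂ}
    {D : (k : Fin K) → Fin (r k) → ℝ} {W : (k : Fin K) → Matrix (Fin (nb k)) (Fin (r k)) ℂ}
    (hsvd : ∀ k, IsThinSVD (c.Htilde k * invSqrt (c.Omega ψ k)) (U k) (D k) (W k))
    {S : (k : Fin K) → Matrix (Fin (nb k)) (Fin (nb k)) ℂ} (hS : c.IsRelaxedOptimal S) :
    S = c.recovered ψ Q U W := by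
  have hval := minimaxSolution_value hV hp hP h hS
  obtain ⟨hψ, hQ, hmax, -⟩ := h
  obtain ⟨T, hT, rfl⟩ := exists_unwhiten_eq hψ.1 (relaxedFeasible_subset hψ hS.1)
  obtain ⟨h1, h2⟩ := dual_covariance (A := c.whitened ψ) hsvd hQ
  rw [sumRate_unwhiten] at hval
  rw [recovered_eq_unwhiten]
  refine congrArg (c.unwhiten ψ) (max_unique (A := c.whitened ψ) (whitened_ne_zero hψ.1 hk) hT
    (fun R hR => ?_) h1 (le_of_eq ?_))
  · obtain ⟨Q', hQ', h3⟩ := exists_dualCovariances hψ.1 (unwhiten_mem hψ.1 hR)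
    rw [sumRate_unwhiten] at h3
    rw [← h3, ← hval]
    exact hmax Q' hQ'
  · rw [h2, ← dualObjective_eq_logRate hψ.1 hQ.1, hval]

theorem rank_recovered_le (Q : (k : Fin K) → Matrix (Fin (n k)) (Fin (n k)) ℂ)
    {r : Fin K → ℕ} (U : (k : Fin K) → Matrix (Fin (n k)) (Fin (r k)) ℂ)
    (W : (k : Fin K) → Matrix (Fin (nb k)) (Fin (r k)) ℂ) (k : Fin K) :
    (c.recovered ψ Q U W k).rank ≤ n k := by
  have h : c.recovered ψ Q U W k = (invSqrt (c.Omega ψ k) * W k * (U k)ᴴ) *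
      (Q k * U k * (W k)ᴴ * invSqrt (c.Omega ψ k)) := by
    simp only [recovered, Matrix.mul_assoc]
  rw [h]
  exact ((Matrix.rank_mul_le _ _).trans (min_le_left _ _)).trans (Matrix.rank_le_width _)

/-- The rank relaxation is tight: cutting a relaxed optimum down to the ranks that the receivers
can resolve changes no rate and only lowers the resource usage. -/
theorem exists_rankFeasible {S : (k : Fin K) → Matrix (Fin (nb k)) (Fin (nb k)) ℂ}
    (hS : S ∈ c.relaxedFeasible) : ∃ T ∈ c.rankFeasible, c.sumRate T = c.sumRate S := by
  rw [mem_relaxedFeasible_iff] at hS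
  choose T hT hST hrate hrank using fun k => (hS.1 k).exists_rank_le (c.Htilde k)
  refine ⟨T, ⟨mem_relaxedFeasible_iff.mpr ⟨hT, fun i => (usage_mono hST i).trans (hS.2 i)⟩,
    hrank⟩, ?_⟩
  simp only [sumRate, hrate]

theorem isGLB_innerMaxima (hV : c.IsZeroForcing) (hp : ∀ i, 0 < c.limits i) (hP : 0 < P)
    {S : (k : Fin K) → Matrix (Fin (nb k)) (Fin (nb k)) ℂ} (hS : c.IsRelaxedOptimal S) :
    IsGLB (innerMaxima c.dualObjective (c.dualMultipliers P) (dualCovariances n P))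
      (c.sumRate S) := by
  refine ⟨?_, fun u hu => le_of_forall_pos_le_add fun ε hε => ?_⟩
  · rintro w ⟨ψ, hψ, -, hw⟩
    obtain ⟨Q, hQ, h⟩ := exists_dual_ge hψ hS.1
    exact h ▸ hw ⟨Q, hQ, rfl⟩
  · obtain ⟨ψ, hψ, hψP, -, hle⟩ := exists_dual_le hV hp hP hS.2 hε
    obtain ⟨Q, hQ, hmax⟩ := exists_dual_max (c := c) hψ hP.le
    refine (hu ⟨ψ, ⟨hψ, hψP⟩, ⟨Q, hQ, rfl⟩, ?_⟩).trans (hle Q hQ)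
    rintro _ ⟨R, hR, rfl⟩
    exact hmax R hR

theorem isGLB_innerMaxima_eq (hV : c.IsZeroForcing) (hp : ∀ i, 0 < c.limits i) (hP : 0 < P)
    {k₀ : Fin K} (hk : c.Htilde k₀ ≠ 0)
    {S : (k : Fin K) → Matrix (Fin (nb k)) (Fin (nb k)) ℂ} (hS : c.IsRelaxedOptimal S) :
    IsGLB (innerMaxima c.dualObjective (c.dualMultipliersEq P) (dualCovariancesEq n P))
      (c.sumRate S) := by
  have hN : 0 < N := by
    rcases Nat.eq_zero_or_pos N with rfl | h
    · refine absurd ?_ hk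
      ext i j
      simp [Htilde, Matrix.mul_apply]
    · exact h
  refine ⟨?_, fun u hu => le_of_forall_pos_le_add fun ε hε => ?_⟩
  · rintro w ⟨ψ, hψ, -, hw⟩
    obtain ⟨Q, hQ, h⟩ := exists_dual_ge ⟨hψ.1, hψ.2.le⟩ hS.1
    obtain ⟨R, hR, h', -⟩ := dual_full_power hψ.1 hk hQ
    exact (h ▸ h').trans (hw ⟨R, hR, rfl⟩)
  · obtain ⟨ψ, hψ, -, hψP, hle⟩ := exists_dual_le hV hp hP hS.2 hε
    obtain ⟨Q, hQ, hmax⟩ := exists_dual_max (c := c) hψ hP.le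
    obtain ⟨R, hR, h, -⟩ := dual_full_power hψ hk hQ
    refine (hu ⟨ψ, ⟨hψ, hψP hN⟩, ⟨R, hR, rfl⟩, ?_⟩).trans
      (hle R (dualCovariancesEq_subset n P hR))
    rintro _ ⟨T, hT, rfl⟩
    exact (hmax T (dualCovariancesEq_subset n P hT)).trans h

end CRNetwork

end

theorem theorem1 {K M N : ℕ} {n nb : Fin K → ℕ} {nt : Fin M → ℕ}
    (c : CRNetwork K M N n nb nt) (hV : c.IsZeroForcing)
    (hpower : ∀ i, 0 < c.power i) (hinterf : ∀ m, 0 < c.interf m)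
    (P : ℝ) (hP : 0 < P) :
    -- the dual objective is convex in the multipliers and concave in the covariances
    (∀ Q ∈ psdTuples n, ConvexOn ℝ c.dualDomain (fun ψ => c.dualObjective ψ Q)) ∧
    (∀ ψ ∈ c.dualDomain, ConcaveOn ℝ (psdTuples n) (c.dualObjective ψ)) ∧
    -- equal optimal values; the rank relaxation is tight
    (∀ ψ ∈ c.dualMultipliers P, ∃ w, IsGreatest (c.dualObjective ψ '' dualCovariances n P) w) ∧
    (∃ v, IsGreatest (c.sumRate '' c.relaxedFeasible) v ∧
      IsGreatest (c.sumRate '' c.rankFeasible) v ∧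
      IsGLB (innerMaxima c.dualObjective (c.dualMultipliers P) (dualCovariances n P)) v ∧
      ((∃ k, c.Htilde k ≠ 0) →
        IsGLB (innerMaxima c.dualObjective (c.dualMultipliersEq P) (dualCovariancesEq n P)) v)) ∧
    -- a solution of the minimax program exists for non-degenerate channels
    ((∀ ψ : Fin N ⊕ Fin M → ℝ, (∀ i, 0 ≤ ψ i) →
        (∀ k, LinearMap.ker (c.Omega ψ k).mulVecLin ≤ LinearMap.ker (c.Htilde k).mulVecLin) →
        ∀ k, (c.Omega ψ k).PosDef) →
      ∃ ψ Q, IsMinimaxSaddle c.dualObjective (c.dualMultipliers P) (dualCovariances n P) ψ Q) ∧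
    -- the constraints may be taken as equalities
    ((∃ k, c.Htilde k ≠ 0) → ∀ ψ Q,
      (IsMinimaxSolution c.dualObjective (c.dualMultipliers P) (dualCovariances n P) ψ Q ↔
        IsMinimaxSolution c.dualObjective (c.dualMultipliersEq P) (dualCovariancesEq n P) ψ Q)) ∧
    -- recovery of the optimal covariances from any solution of the minimax program
    ((∃ k, c.Htilde k ≠ 0) → ∀ ψ Q,
      IsMinimaxSolution c.dualObjective (c.dualMultipliers P) (dualCovariances n P) ψ Q →
      (∀ k, ∃ (r : ℕ) (U : Matrix (Fin (n k)) (Fin r) ℂ) (D : Fin r → ℝ)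
        (W : Matrix (Fin (nb k)) (Fin r) ℂ),
          IsThinSVD (c.Htilde k * invSqrt (c.Omega ψ k)) U D W) ∧
      (∀ (r : Fin K → ℕ) (U : (k : Fin K) → Matrix (Fin (n k)) (Fin (r k)) ℂ)
        (D : (k : Fin K) → Fin (r k) → ℝ)
        (W : (k : Fin K) → Matrix (Fin (nb k)) (Fin (r k)) ℂ),
        (∀ k, IsThinSVD (c.Htilde k * invSqrt (c.Omega ψ k)) (U k) (D k) (W k)) →
        ∀ S, c.IsRelaxedOptimal S ↔ S = c.recovered ψ Q U W) ∧
      ∀ S, c.IsRelaxedOptimal S → ∀ k, (S k).rank ≤ n k) := by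
  have hp := CRNetwork.limits_pos hpower hinterf
  obtain ⟨S, hS⟩ := CRNetwork.exists_relaxed_max hV hp
  refine ⟨fun Q hQ => CRNetwork.convexOn_dualObjective hQ,
    fun ψ hψ => CRNetwork.concaveOn_dualObjective hψ, fun ψ hψ => ?_,
    ⟨c.sumRate S, ⟨⟨S, hS.1, rfl⟩, ?_⟩, ⟨?_, ?_⟩, CRNetwork.isGLB_innerMaxima hV hp hP hS,
      fun ⟨k, hk⟩ => CRNetwork.isGLB_innerMaxima_eq hV hp hP hk hS⟩,
    CRNetwork.exists_saddle hV hp hP,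
    fun ⟨k, hk⟩ ψ Q => CRNetwork.minimaxSolution_iff_eq hp hP hk,
    fun ⟨k₀, hk⟩ ψ Q hsol => ⟨fun k => exists_isThinSVD _, fun r U D W hsvd T => ?_,
      fun T hT k => ?_⟩⟩
  · obtain ⟨Q, hQ, hmax⟩ := CRNetwork.exists_dual_max (c := c) hψ.1 hP.le
    refine ⟨_, ⟨Q, hQ, rfl⟩, ?_⟩
    rintro _ ⟨R, hR, rfl⟩
    exact hmax R hR
  · rintro _ ⟨T, hT, rfl⟩
    exact hS.2 T hT
  · obtain ⟨T, hT, h⟩ := CRNetwork.exists_rankFeasible hS.1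
    exact ⟨T, hT, h⟩
  · rintro _ ⟨T, hT, rfl⟩
    exact hS.2 T hT.1
  · refine ⟨CRNetwork.eq_recovered hV hp hP hk hsol hsvd, fun h => ?_⟩
    rw [h, ← CRNetwork.eq_recovered hV hp hP hk hsol hsvd hS]
    exact hS
  · choose r U D W hsvd using fun k => exists_isThinSVD (c.Htilde k * invSqrt (c.Omega ψ k))
    rw [CRNetwork.eq_recovered hV hp hP hk hsol hsvd hT]
    exact CRNetwork.rank_recovered_le Q U W k
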